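/- **Conventions.** A *positive Heyting category* is a regular category with disjoint, pullback-stable finite sums in which every pullback map $f^*:\mathrm{Sub}(X)\to\mathrm{Sub}(Y)$ ($f:Y\to X$) has a right adjoint $\forall_f$. A *cover* is a map that factors through no proper subobject of its codomain. A commutative square with left side $f:D\to B$, right side $g:C\to A$ and bottom $p:B\to A$ is a *covering square* (and $f$ *covers* $g$) if $p$ and the canonical map $D\to B\times_A C$ are covers. A *class of small maps* in a positive Heyting category is a class $\mathcal S$ of maps such that: - (A1) $\mathcal S$ is stable under pullback; - (A2) if a pullback of $f$ along a cover is in $\mathcal S$, so is $f$; - (A3) $f,f'\in\mathcal S$ implies $f+f'\in\mathcal S$; - (A4) $0\to1$, $1\to1$ and $1+1\to1$ are in $\mathcal S$; - (A5) $\mathcal S$ is closed under composition; - (A6) if $gf\in\mathcal S$ and $f$ is a cover, then $g\in\mathcal S$; - (A7) (collection) for every cover $p:Y\to X$ and every $f:X\to A$ in $\mathcal S$ there are $g:Z\to B$ in $\mathcal S$, $q:Z\to Y$ and $h:B\to A$ such that the square with top $pq$, left side $g$, right side $f$ and bottom $h$ is covering; - (A8) for $f\in\mathcal S$, $\forall_f$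 sends monos in $\mathcal S$ to monos in $\mathcal S$; - (A9) all diagonals $X\to X\times X$ are in $\mathcal S$. A *category with small maps* is a positive Heyting category with a class of small maps. It satisfies *representability* if there is $\pi\in\mathcal S$ such that every $f\in\mathcal S$ is covered by some pullback of $\pi$. It is *predicative* if it satisfies representability, all maps in $\mathcal S$ are exponentiable and have W-types (initial algebras of their polynomial functors), there is a natural numbers object $N$ with $N\to 1$ in $\mathcal S$, and every equivalence relation $R\rightarrowtail X\times X$ in $\mathcal S$ has a stable quotient. **Setting.** Let $(\mathcal E,\mathcal S)$ be a predicative category with small maps, and let $\mathbb C$ be an internal category in $\mathcal E$ whose codomain map $\mathrm{cod}:\mathbb C_1\to\mathbb C_0$ is in $\mathcal S$. Let $\mathrm{Psh}_{\mathcal E}(\mathbb C)$ be the category of internal presheaves on $\mathbb C$, and $\pi^*:\mathrm{Psh}_{\mathcal E}(\mathbb C)\to\mathcal E/\mathbb C_0$ the forgetful functor. Let $\pi_!$ be its left adjoint: for $\sigma_A:A\to\mathbb C_0$, $\pi_!A$ consists of the pairs $(x,f)$ with $x\in A$, $f\in\mathbb C_1$ and $\mathrm{cod}\,f=\sigma_A(x)$,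 lies over $\mathrm{dom}\,f$, and has restriction $(x,f)\cdot g=(x,fg)$. For objects $\sigma_A:A\to\mathbb C_0$ and $\sigma_B:B\to\mathbb C_0$, maps $r:B\to A$ and $s:B\to\mathbb C_1$ in $\mathcal E$ with $\mathrm{dom}\circ s=\sigma_B$ and $\mathrm{cod}\circ s=\sigma_A\circ r$ determine a presheaf map $(r,s)_!:\pi_!B\to\pi_!A$, $(b,f)\mapsto(r(b),s_b f)$. A map $F$ of presheaves is *pointwise small* if $\pi^*F$ is, as a map of $\mathcal E$, in $\mathcal S$; it is *locally small* if it is covered, in $\mathrm{Psh}_{\mathcal E}(\mathbb C)$, by some $(r,s)_!$ with $r\in\mathcal S$. **Statement.** 1. $\mathrm{Psh}_{\mathcal E}(\mathbb C)$ is a positive Heyting category, and the pointwise small maps satisfy (A1)–(A9) in it; thus they make it a category with small maps. 2. A map of presheaves is pointwise small if and only if it is locally small. 3. The class of pointwise small maps of presheaves satisfies the collection axiom (A7) and the representability axiom. -/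

import Mathlib

open CategoryTheory CategoryTheory.Limits

universe v u

namespace SmallMaps

section Ambient

variable {E : Type u} [Category.{v} E]

variable (E) in
/-- Positive Heyting categories: regular categories (finite limits are part of `Regular`) with
disjoint and pullback-stable finite sums, in which the pullback maps between subobject posets
have right adjoints. -/
class PositiveHeyting : Prop extends
    Regular E, FinitaryPreExtensive E, BinaryCoproductsDisjoint E where
  exists_forall {X Y : E} (f : Y ⟶ X) :
    ∃ R : Subobject Y → Subobject X, GaloisConnection (Subobject.pullback f).obj R

/-- A commutative square
```
  D --t--> C
  |        |
  f        g
  v        v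
  B --p--> A
```
is a quasi-pullback if the canonical map from `D` to the pullback of `p` and `g` is a cover.
Covers are Mathlib's extremal epimorphisms: the maps which factor through no proper subobject of
their codomain. -/
def QuasiPullback {D C B A : E} (t : D ⟶ C) (f : D ⟶ B) (g : C ⟶ A) (p : B ⟶ A) : Prop :=
  ∃ (P : E) (π₁ : P ⟶ B) (π₂ : P ⟶ C) (e : D ⟶ P),
    IsPullback π₁ π₂ p g ∧ e ≫ π₁ = f ∧ e ≫ π₂ = t ∧ ExtremalEpi e

/-- A covering square is a quasi-pullback whose bottom map `p` is also a cover. -/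
def CoveringSquare {D C B A : E} (t : D ⟶ C) (f : D ⟶ B) (g : C ⟶ A) (p : B ⟶ A) : Prop :=
  QuasiPullback t f g p ∧ ExtremalEpi p

/-- `f` covers `g`: they are the vertical sides of a covering square. -/
def Covers {D C B A : E} (f : D ⟶ B) (g : C ⟶ A) : Prop :=
  ∃ (t : D ⟶ C) (p : B ⟶ A), CoveringSquare t f g p

/-- The collection axiom (A7). -/
def Collection (S : MorphismProperty E) : Prop :=
  ∀ ⦃Y X A : E⦄ (p : Y ⟶ X) (f : X ⟶ A), ExtremalEpi p → S f →
    ∃ (Z B : E) (q : Z ⟶ Y) (g : Z ⟶ B) (h : B ⟶ A), S g ∧ CoveringSquare (q ≫ p) g f h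

/-- The representability axiom: there is a universal small map. -/
def Representability (S : MorphismProperty E) : Prop :=
  ∃ (V U : E) (π : V ⟶ U), S π ∧
    ∀ ⦃Y X : E⦄ (f : Y ⟶ X), S f →
      ∃ (B A : E) (g : B ⟶ A) (t : B ⟶ Y) (p : A ⟶ X) (m : B ⟶ V) (n : A ⟶ U),
        CoveringSquare t g f p ∧ IsPullback m g π n

/-- A class of small maps in a positive Heyting category: axioms (A1)-(A9). -/
structure IsClassOfSmallMaps [PositiveHeyting E] (S : MorphismProperty E) : Prop where
  /-- (A1) -/
  pullback_stable {D B C A : E} {t : D ⟶ B} {g : D ⟶ C} {f : B ⟶ A} {p : C ⟶ A} :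
    IsPullback t g f p → S f → S g
  /-- (A2) -/
  descent {D B C A : E} {t : D ⟶ B} {g : D ⟶ C} {f : B ⟶ A} {p : C ⟶ A} :
    IsPullback t g f p → ExtremalEpi p → S g → S f
  /-- (A3) -/
  sums {X Y X' Y' : E} {f : X ⟶ Y} {f' : X' ⟶ Y'} : S f → S f' → S (coprod.map f f')
  /-- (A4) -/
  zero_small : S (initial.to (⊤_ E))
  one_small : S (𝟙 (⊤_ E))
  two_small : S (coprod.desc (𝟙 (⊤_ E)) (𝟙 (⊤_ E)))
  /-- (A5) -/
  comp_small {X Y Z : E} {f : X ⟶ Y} {g : Y ⟶ Z} : S f → S g → S (f ≫ g)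
  /-- (A6) -/
  quotients {Z Y X : E} {f : Z ⟶ Y} {g : Y ⟶ X} : ExtremalEpi f → S (f ≫ g) → S g
  /-- (A7) -/
  collection : Collection S
  /-- (A8); `R` is the right adjoint of pullback of subobjects along `f`. -/
  heyting {Y X : E} (f : Y ⟶ X) (R : Subobject Y → Subobject X) :
    S f → GaloisConnection (Subobject.pullback f).obj R →
      ∀ A : Subobject Y, S A.arrow → S (R A).arrow
  /-- (A9) -/
  diagonals (X : E) : S (prod.lift (𝟙 X) (𝟙 X))

/-- `(N, z, s)` is a natural numbers object. -/
def IsNNO [HasTerminal E] {N : E} (z : ⊤_ E ⟶ N) (s : N ⟶ N) : Prop :=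
  ∀ ⦃X : E⦄ (x : ⊤_ E ⟶ X) (t : X ⟶ X), ∃! h : N ⟶ X, z ≫ h = x ∧ s ≫ h = h ≫ t

/-- A pair of parallel maps is an (internal) equivalence relation: it is jointly monic, and on
generalized elements it is an equivalence relation. -/
structure IsEquivRel {R X : E} (r₀ r₁ : R ⟶ X) : Prop where
  jointly_mono ⦃T : E⦄ (a b : T ⟶ R) : a ≫ r₀ = b ≫ r₀ → a ≫ r₁ = b ≫ r₁ → a = b
  equivalence (T : E) :
    Equivalence fun x y : T ⟶ X => ∃ c : T ⟶ R, c ≫ r₀ = x ∧ c ≫ r₁ = y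

/-- `R ⇉ X ⟶ Q` is exact: a pullback as well as a coequalizer. -/
def IsExactFork {R X Q : E} (r₀ r₁ : R ⟶ X) (q : X ⟶ Q) : Prop :=
  IsPullback r₀ r₁ q q ∧
    ∀ ⦃Z : E⦄ (k : X ⟶ Z), r₀ ≫ k = r₁ ≫ k → ∃! l : Q ⟶ Z, q ≫ l = k

/-- `R ⇉ X ⟶ Q` is stably exact, that is, `q` is a stable quotient of `R`: the fork is exact and
so is its pullback along any map into `Q`. -/
def IsStableQuotient {R X Q : E} (r₀ r₁ : R ⟶ X) (q : X ⟶ Q) : Prop :=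
  IsExactFork r₀ r₁ q ∧
    ∀ ⦃R' X' Q' : E⦄ (r₀' r₁' : R' ⟶ X') (q' : X' ⟶ Q') (a : R' ⟶ R) (b : X' ⟶ X) (c : Q' ⟶ Q),
      IsPullback b q' q c → IsPullback a r₀' r₀ b → IsPullback a r₁' r₁ b →
      r₀' ≫ q' = r₁' ≫ q' → IsExactFork r₀' r₁' q'

/-- A class of small maps `S` making the ambient positive Heyting category a predicative category
with small maps. -/
structure IsPredicative [PositiveHeyting E] (S : MorphismProperty E) : Prop
    extends IsClassOfSmallMaps S where
  /-- (ΠE) Small maps are exponentiable. -/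
  exponentiable {X Y : E} (f : X ⟶ Y) : S f → (Over.pullback f).IsLeftAdjoint
  /-- (WE) The polynomial functor of a small map, formed using the right adjoint `Pi` of pullback
  along it, has an initial algebra. -/
  wtypes {X Y : E} (f : X ⟶ Y) (Pi : Over X ⥤ Over Y) :
    S f → Nonempty (Over.pullback f ⊣ Pi) →
      HasInitial (Endofunctor.Algebra (Over.star X ⋙ Pi ⋙ Over.forget Y))
  /-- (NE) -/
  exists_nno : ∃ (N : E) (z : ⊤_ E ⟶ N) (s : N ⟶ N), IsNNO z s
  /-- (NS) -/
  nno_small {N : E} (z : ⊤_ E ⟶ N) (s : N ⟶ N) : IsNNO z s → S (terminal.from N)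
  representability : Representability S
  bounded_exactness {R X : E} (r₀ r₁ : R ⟶ X) : IsEquivRel r₀ r₁ → S (prod.lift r₀ r₁) →
    ∃ (Q : E) (q : X ⟶ Q), IsStableQuotient r₀ r₁ q

end Ambient

section Presheaves

variable {E : Type u} [Category.{v} E] [HasPullbacks E]

attribute [local simp] pullback.lift_fst pullback.lift_snd
attribute [local simp] pullback.lift_fst_assoc pullback.lift_snd_assoc

variable (E) in
/-- An internal category in `E`. The laws are expressed for generalized elements, and the composite
of a pair `(f, g)` with `dom f = cod g` is `f ∘ g`. -/
structure InternalCategory where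
  C₀ : E
  C₁ : E
  dom : C₁ ⟶ C₀
  cod : C₁ ⟶ C₀
  ident : C₀ ⟶ C₁
  comp : pullback dom cod ⟶ C₁
  ident_dom : ident ≫ dom = 𝟙 C₀
  ident_cod : ident ≫ cod = 𝟙 C₀
  comp_dom : comp ≫ dom = pullback.snd dom cod ≫ dom
  comp_cod : comp ≫ cod = pullback.fst dom cod ≫ cod
  ident_comp {T : E} (f : T ⟶ C₁) :
    pullback.lift (f ≫ cod ≫ ident) f (by simp [ident_dom]) ≫ comp = f
  comp_ident {T : E} (f : T ⟶ C₁) :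
    pullback.lift f (f ≫ dom ≫ ident) (by simp [ident_cod]) ≫ comp = f
  assoc {T : E} (f g h : T ⟶ C₁) (hfg : f ≫ dom = g ≫ cod) (hgh : g ≫ dom = h ≫ cod) :
    pullback.lift (pullback.lift f g hfg ≫ comp) h (by simpa [comp_dom] using hgh) ≫ comp =
      pullback.lift f (pullback.lift g h hgh ≫ comp) (by simpa [comp_cod] using hfg) ≫ comp

/-- An internal presheaf on `C`: an object `σ : X ⟶ C₀` over `C₀` together with a restriction
operation `(x, f) ↦ x · f`, defined when `σ x = cod f`, with `σ (x · f) = dom f`, satisfying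
`x · id = x` and `x · (f ∘ g) = (x · f) · g`. -/
structure Presheaf (C : InternalCategory E) where
  obj : Over C.C₀
  act : pullback obj.hom C.cod ⟶ obj.left
  act_hom : act ≫ obj.hom = pullback.snd obj.hom C.cod ≫ C.dom
  act_ident {T : E} (x : T ⟶ obj.left) :
    pullback.lift x (x ≫ obj.hom ≫ C.ident) (by simp [C.ident_cod]) ≫ act = x
  act_comp {T : E} (x : T ⟶ obj.left) (f g : T ⟶ C.C₁) (hf : x ≫ obj.hom = f ≫ C.cod)
    (hg : f ≫ C.dom = g ≫ C.cod) :
    pullback.lift x (pullback.lift f g hg ≫ C.comp) (by simpa [C.comp_cod] using hf) ≫ act =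
      pullback.lift (pullback.lift x f hf ≫ act) g (by simpa [act_hom] using hg) ≫ act

namespace Presheaf

variable {C : InternalCategory E}

/-- Morphisms of presheaves: maps over `C₀` which commute with restriction. -/
@[ext]
structure Hom (X Y : Presheaf C) where
  hom : X.obj ⟶ Y.obj
  comm : X.act ≫ hom.left =
    pullback.lift (pullback.fst X.obj.hom C.cod ≫ hom.left) (pullback.snd X.obj.hom C.cod)
      (by simp [pullback.condition]) ≫ Y.act

theorem Hom.comm_apply {X Y : Presheaf C} (F : Hom X Y) {T : E} (x : T ⟶ X.obj.left)
    (f : T ⟶ C.C₁) (h : x ≫ X.obj.hom = f ≫ C.cod) :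
    (pullback.lift x f h ≫ X.act) ≫ F.hom.left =
      pullback.lift (x ≫ F.hom.left) f (by simpa using h) ≫ Y.act := by
  rw [Category.assoc, F.comm, ← Category.assoc]
  congr 1
  apply pullback.hom_ext <;> simp

instance : Category (Presheaf C) where
  Hom := Hom
  id X := ⟨𝟙 X.obj, by
    have : pullback.lift (pullback.fst X.obj.hom C.cod ≫ 𝟙 X.obj.left)
        (pullback.snd X.obj.hom C.cod) (by simp [pullback.condition]) =
        𝟙 (pullback X.obj.hom C.cod) := by
      apply pullback.hom_ext <;> simp
    simp⟩
  comp {X Y Z} F G := ⟨F.hom ≫ G.hom, by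
    have h := G.comm_apply (pullback.fst X.obj.hom C.cod ≫ F.hom.left)
      (pullback.snd X.obj.hom C.cod) (by simp [pullback.condition])
    rw [← F.comm, Category.assoc] at h
    refine h.trans ?_
    congr 1
    apply pullback.hom_ext <;> simp⟩
  id_comp F := Hom.ext (Category.id_comp F.hom)
  comp_id F := Hom.ext (Category.comp_id F.hom)
  assoc F G H := Hom.ext (Category.assoc F.hom G.hom H.hom)

end Presheaf

variable (C : InternalCategory E)

/-- The forgetful functor `π^*` from presheaves to the slice `E / C₀`. -/
def piStar : Presheaf C ⥤ Over C.C₀ where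
  obj X := X.obj
  map F := F.hom

/-- A map of presheaves is pointwise small if its image under `π^*` belongs to `S / C₀`. -/
def pointwiseSmall (S : MorphismProperty E) : MorphismProperty (Presheaf C) :=
  S.over.inverseImage (piStar C)

variable {C}

/-- The restriction operation `((x, f), g) ↦ (x, f ∘ g)` of the presheaf `π_! A`. -/
noncomputable def shriekAct (A : Over C.C₀) :
    pullback (pullback.snd A.hom C.cod ≫ C.dom) C.cod ⟶ pullback A.hom C.cod :=
  pullback.lift
    (pullback.fst (pullback.snd A.hom C.cod ≫ C.dom) C.cod ≫ pullback.fst A.hom C.cod)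
    (pullback.lift
      (pullback.fst (pullback.snd A.hom C.cod ≫ C.dom) C.cod ≫ pullback.snd A.hom C.cod)
      (pullback.snd (pullback.snd A.hom C.cod ≫ C.dom) C.cod)
      (by simpa using pullback.condition) ≫ C.comp)
    (by simp [C.comp_cod, pullback.condition])

theorem lift_shriekAct (A : Over C.C₀) {T : E} (x : T ⟶ A.left) (f g : T ⟶ C.C₁)
    (hx : x ≫ A.hom = f ≫ C.cod)
    (h : pullback.lift x f hx ≫ pullback.snd A.hom C.cod ≫ C.dom = g ≫ C.cod) :
    pullback.lift (pullback.lift x f hx) g h ≫ shriekAct A =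
      pullback.lift x (pullback.lift f g (by simpa using h) ≫ C.comp)
        (by simpa [C.comp_cod] using hx) := by
  apply pullback.hom_ext
  · simp [shriekAct]
  · simp only [shriekAct, Category.assoc, pullback.lift_snd]
    rw [← Category.assoc]
    congr 1
    apply pullback.hom_ext <;> simp

theorem eq_lift {X Y Z T : E} {a : X ⟶ Z} {b : Y ⟶ Z} (x : T ⟶ pullback a b) :
    x = pullback.lift (x ≫ pullback.fst a b) (x ≫ pullback.snd a b)
      (by simp [pullback.condition]) := by
  apply pullback.hom_ext <;> simp

/-- The presheaf `π_! A` of pairs `(x, f)` with `σ x = cod f`, lying over `dom f`, and with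
`(x, f) · g = (x, f ∘ g)`. -/
noncomputable def piShriek (A : Over C.C₀) : Presheaf C where
  obj := Over.mk (pullback.snd A.hom C.cod ≫ C.dom)
  act := shriekAct A
  act_hom := by simp [shriekAct, C.comp_dom]
  act_ident {T} x := by
    change T ⟶ pullback A.hom C.cod at x
    obtain ⟨y, f, h, rfl⟩ : ∃ y f h, x = pullback.lift y f h := ⟨_, _, _, eq_lift x⟩
    dsimp only [Over.mk_left, Over.mk_hom]
    rw [lift_shriekAct]
    apply pullback.hom_ext
    · simp
    · have := C.comp_ident f
      simpa using this
  act_comp {T} x f g hf hg := by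
    change T ⟶ pullback A.hom C.cod at x
    obtain ⟨y, k, h, rfl⟩ : ∃ y f h, x = pullback.lift y f h := ⟨_, _, _, eq_lift x⟩
    have hkf : k ≫ C.dom = f ≫ C.cod := by simpa using hf
    have key := C.assoc k f g hkf hg
    dsimp only [Over.mk_left, Over.mk_hom] at hf ⊢
    simp only [lift_shriekAct]
    apply pullback.hom_ext
    · simp
    · simpa using key.symm

/-- The underlying map of `transpose`. -/
noncomputable def transposeHom {B : Over C.C₀} {Y : Presheaf C} (u : B ⟶ Y.obj) :
    Over.mk (pullback.snd B.hom C.cod ≫ C.dom) ⟶ Y.obj :=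
  Over.homMk
    (pullback.lift (pullback.fst B.hom C.cod ≫ u.left) (pullback.snd B.hom C.cod)
      (by simp [pullback.condition]) ≫ Y.act)
    (by simp [Y.act_hom])

/-- The map of presheaves `π_! B ⟶ Y`, `(b, f) ↦ u b · f`, which is the transpose of a map
`u : B ⟶ π^* Y` over `C₀`. -/
noncomputable def transpose {B : Over C.C₀} {Y : Presheaf C} (u : B ⟶ (piStar C).obj Y) :
    piShriek B ⟶ Y where
  hom := transposeHom u
  comm := by
    change B ⟶ Y.obj at u
    change shriekAct B ≫ (transposeHom u).left =
      pullback.lift (pullback.fst (pullback.snd B.hom C.cod ≫ C.dom) C.cod ≫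
        (transposeHom u).left) (pullback.snd (pullback.snd B.hom C.cod ≫ C.dom) C.cod) _ ≫ Y.act
    have key := Y.act_comp
      (pullback.fst (pullback.snd B.hom C.cod ≫ C.dom) C.cod ≫ pullback.fst B.hom C.cod ≫ u.left)
      (pullback.fst (pullback.snd B.hom C.cod ≫ C.dom) C.cod ≫ pullback.snd B.hom C.cod)
      (pullback.snd (pullback.snd B.hom C.cod ≫ C.dom) C.cod)
      (by simp [pullback.condition]) (by simpa using pullback.condition)
    simp only [transposeHom, Over.homMk_left]
    rw [← Category.assoc]
    refine Eq.trans ?_ (key.trans ?_)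
    · congr 1
      apply pullback.hom_ext <;> simp [shriekAct]
    · congr 1
      apply pullback.hom_ext
      · simp only [pullback.lift_fst]
        refine Eq.trans ?_ (Category.assoc _ _ _)
        congr 1
        apply pullback.hom_ext <;> simp
      · simp

/-- The map `(r, s) : B ⟶ π^* π_! A` over `C₀` given by `r : B ⟶ A` in `E` and a family of arrows
`s b : σ b ⟶ σ (r b)` of `C`. -/
noncomputable def pairMap {B A : Over C.C₀} (r : B.left ⟶ A.left) (s : B.left ⟶ C.C₁)
    (hdom : s ≫ C.dom = B.hom) (hcod : s ≫ C.cod = r ≫ A.hom) :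
    B ⟶ (piStar C).obj (piShriek A) :=
  (Over.homMk (pullback.lift r s hcod.symm) (by simp [hdom]) :
    B ⟶ Over.mk (pullback.snd A.hom C.cod ≫ C.dom))

/-- The map of presheaves `(r, s)_! : π_! B ⟶ π_! A`, `(b, f) ↦ (r b, s b ∘ f)`. -/
noncomputable def shriekMap {B A : Over C.C₀} (r : B.left ⟶ A.left) (s : B.left ⟶ C.C₁)
    (hdom : s ≫ C.dom = B.hom) (hcod : s ≫ C.cod = r ≫ A.hom) : piShriek B ⟶ piShriek A :=
  transpose (pairMap r s hdom hcod)

variable (C) in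
/-- A map of presheaves is locally small if it is covered by a map `(r, s)_!` with `r` small. -/
def locallySmall (S : MorphismProperty E) : MorphismProperty (Presheaf C) := fun _ _ F =>
  ∃ (B A : Over C.C₀) (r : B.left ⟶ A.left) (s : B.left ⟶ C.C₁)
    (hdom : s ≫ C.dom = B.hom) (hcod : s ≫ C.cod = r ≫ A.hom),
    S r ∧ Covers (shriekMap r s hdom hcod) F

end Presheaves

end SmallMaps

/-!
Write `T` for the endofunctor `π^* π_! = dom_! cod^*` of `E / C₀`. The forgetful functor `π^*` is
monadic over `E / C₀`, with monad `T` (`MonadicRightAdjoint (piStar C)`), so it creates limits. The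
naturality squares of the projection `T A ⟶ A` are pullbacks in `E` (`isPullback_shriek_map`).
Since finite sums and covers in `E` are stable under pullback, `T` preserves both. Hence finite
limits, finite sums and images of presheaves are computed in `E / C₀`, and a map of presheaves is a
cover if and only if its underlying map is one (`extremalEpi_iff`). This makes
presheaves a regular category with disjoint and stable finite sums. Only universal quantification is
not computed on underlying objects: `x` belongs to `∀_F A` if and only if `A` contains the fibres of
`F` over all the restrictions `x · f` (`exists_forall_obj`). The range of `f` here is a pullback of
`cod`, and so universal quantification along pointwise small maps preserves smallness.

With this, the axioms other than collection hold for pointwise small maps because they hold for the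
underlying maps (`isClassOfSmallMaps_pointwiseSmall`). The other claims rest on the equivalence of
pointwise and local smallness. The counit `π_! π^* X ⟶ X` is a cover, and the pullback of a
pointwise small `F : Y ⟶ X` along it, precomposed with the counit of the pullback, is a map
`(r, s)_!` with `r` small (`locallySmall_of_pointwiseSmall`). Conversely `(r, s)_!` is pointwise
small when `r` is small (`pointwiseSmall_shriekMap`), and pointwise smallness descends along
covering squares.

Finally, `π_!` takes a covering square or a pullback square from a map `g` to a map `r` in `E` to
such a square from `(g, s')_!` to `(r, s)_!`, where `s'` is the composite of `s` with the top of the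
square (`coveringSquare_shriekMap`, `isPullback_shriekMap`). As covering squares can be pasted, it
suffices to treat the maps `(r, s)_!`, and collection follows from collection in `E`
(`collection_pointwiseSmall`). For representability, let `π : V ⟶ U` be a universal small map of
`E`. Exponentiability of small maps gives an object of `E` classifying the families `s` of arrows of
`C` with a common codomain which are indexed by a fibre of `π` (`exists_universal_family`). The
corresponding map `(r₀, s₀)_!` represents pointwise small maps (`representability_pointwiseSmall`).
-/

namespace SmallMaps

attribute [local simp] pullback.lift_fst pullback.lift_snd prod.lift_fst prod.lift_snd
attribute [local simp] pullback.lift_fst_assoc pullback.lift_snd_assoc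
attribute [local simp] prod.lift_fst_assoc prod.lift_snd_assoc
attribute [local simp] coprod.inl_desc coprod.inr_desc coprod.inl_desc_assoc coprod.inr_desc_assoc

/-! ### Covers and quasi-pullbacks in regular categories -/

section Regular

variable {E : Type u} [Category.{v} E]

theorem extremalEpi_comp [HasPullbacks E] {X Y Z : E} {f : X ⟶ Y} {g : Y ⟶ Z}
    (hf : ExtremalEpi f) (hg : ExtremalEpi g) : ExtremalEpi (f ≫ g) := by
  rw [extremalEpi_iff_strongEpi_of_hasPullbacks] at *
  exact strongEpi_comp f g

theorem extremalEpi_of_isPullback [Regular E] {D C B A : E} {t : D ⟶ B} {g : D ⟶ C} {f : B ⟶ A}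
    {p : C ⟶ A} (h : IsPullback t g f p) (hf : ExtremalEpi f) : ExtremalEpi g := by
  have : IsRegularEpi g :=
    Regular.regularEpiIsStableUnderBaseChange.of_isPullback h
      (Regular.isRegularEpi_of_extremalEpi f)
  infer_instance

theorem QuasiPullback.w {D C B A : E} {t : D ⟶ C} {f : D ⟶ B} {g : C ⟶ A} {p : B ⟶ A}
    (h : QuasiPullback t f g p) : f ≫ p = t ≫ g := by
  obtain ⟨P, π₁, π₂, e, hP, rfl, rfl, -⟩ := h
  simp [hP.w]

theorem QuasiPullback.of_isPullback {D C B A : E} {t : D ⟶ C} {f : D ⟶ B} {g : C ⟶ A}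
    {p : B ⟶ A} (h : IsPullback f t p g) : QuasiPullback t f g p :=
  ⟨D, f, t, 𝟙 D, h, by simp, by simp, inferInstance⟩

theorem QuasiPullback.precomp [HasPullbacks E] {D' D C B A : E} {t : D ⟶ C} {f : D ⟶ B}
    {g : C ⟶ A} {p : B ⟶ A} (h : QuasiPullback t f g p) {e : D' ⟶ D} (he : ExtremalEpi e) :
    QuasiPullback (e ≫ t) (e ≫ f) g p := by
  obtain ⟨P, π₁, π₂, e', hP, rfl, rfl, he'⟩ := h
  exact ⟨P, π₁, π₂, e ≫ e', hP, by simp, by simp, extremalEpi_comp he he'⟩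

theorem QuasiPullback.paste [Regular E] {D C C' B A A' : E} {t : D ⟶ C} {f : D ⟶ B} {g : C ⟶ A}
    {p : B ⟶ A} {t' : C ⟶ C'} {g' : C' ⟶ A'} {p' : A ⟶ A'} (h : QuasiPullback t f g p)
    (h' : QuasiPullback t' g g' p') : QuasiPullback (t ≫ t') f g' (p ≫ p') := by
  obtain ⟨P, π₁, π₂, e, hP, rfl, rfl, he⟩ := h
  obtain ⟨P', π₁', π₂', e', hP', rfl, rfl, he'⟩ := h'
  let l : P ⟶ pullback p π₁' := pullback.lift π₁ (π₂ ≫ e') (by simp [hP.w])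
  have hQ := IsPullback.of_hasPullback p π₁'
  have hl : IsPullback π₂ l e' (pullback.snd p π₁') := by
    refine (IsPullback.of_right ?_ ?_ hQ).flip
    · simpa [l] using hP
    · simp [l]
  refine ⟨_, pullback.fst p π₁', pullback.snd p π₁' ≫ π₂', e ≫ l,
    (hQ.flip.paste_horiz hP'.flip).flip, ?_, ?_, ?_⟩
  · simp [l]
  · simp [l]
  · exact extremalEpi_comp he (extremalEpi_of_isPullback hl he')

theorem CoveringSquare.paste [Regular E] {D C C' B A A' : E} {t : D ⟶ C} {f : D ⟶ B} {g : C ⟶ A}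
    {p : B ⟶ A} {t' : C ⟶ C'} {g' : C' ⟶ A'} {p' : A ⟶ A'} (h : CoveringSquare t f g p)
    (h' : CoveringSquare t' g g' p') : CoveringSquare (t ≫ t') f g' (p ≫ p') :=
  ⟨h.1.paste h'.1, extremalEpi_comp h.2 h'.2⟩

/-- Kripke–Joyal semantics of universal quantification: a generalized element `k` of `X` belongs to
`∀_f A` if and only if the fibre of `f` over `k` is contained in `A`. -/
theorem forall_factors_iff [Regular E] {X Y T P : E} {f : Y ⟶ X}
    {R : Subobject Y → Subobject X} (hR : GaloisConnection (Subobject.pullback f).obj R)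
    (A : Subobject Y) {k : T ⟶ X} {a : P ⟶ T} {b : P ⟶ Y} (h : IsPullback b a f k) :
    (R A).Factors k ↔ A.Factors b := by
  -- Replacing `k` by its image reduces the claim to the adjunction.
  let F := Regular.strongEpiMonoFactorisation k
  have hF : IsRegularEpi F.e :=
    inferInstanceAs (IsRegularEpi (Regular.strongEpiMonoFactorisation k).e)
  have : Mono F.m := F.m_mono
  have h₁ : (R A).Factors k ↔ Subobject.mk F.m ≤ R A := by
    constructor
    · intro hk
      have sq : CommSq ((R A).factorThru k hk) F.e (R A).arrow F.m := ⟨by simp [F]⟩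
      have : StrongEpi F.e := inferInstance
      exact Subobject.mk_le_of_comm sq.lift sq.fac_right
    · intro hk
      have : (R A).Factors F.m := Subobject.factors_of_le _ hk (Subobject.mk_factors_self _)
      rw [← F.fac]
      exact Subobject.factors_of_factors_right _ this
  let Q := Subobject.mk F.m
  have hQ : IsPullback (Subobject.pullbackπ f Q ≫ (Subobject.underlyingIso F.m).hom)
      ((Subobject.pullback f).obj Q).arrow F.m f := by
    refine (Subobject.isPullback f Q).of_iso (Iso.refl _) (Subobject.underlyingIso F.m)
      (Iso.refl _) (Iso.refl _) ?_ ?_ ?_ ?_ <;> simp [Q]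
  let l : P ⟶ _ := hQ.lift (a ≫ F.e) b (by simp [h.w])
  have hl : ExtremalEpi l := by
    have : IsPullback a l F.e
        (Subobject.pullbackπ f Q ≫ (Subobject.underlyingIso F.m).hom) := by
      refine IsPullback.flip (IsPullback.of_right (h₁₂ := ((Subobject.pullback f).obj Q).arrow)
        (v₁₃ := f) (h₂₂ := F.m) ?_ (by simp [l]) hQ.flip)
      simpa [l] using h
    exact extremalEpi_of_isPullback this inferInstance
  rw [h₁, ← hR]
  constructor
  · intro hle
    have hb : b = l ≫ ((Subobject.pullback f).obj Q).arrow := by simp [l]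
    rw [hb]
    exact Subobject.factors_of_factors_right _
      (Subobject.factors_of_le _ hle (Subobject.factors_self _))
  · intro hb
    have : StrongEpi l := (extremalEpi_iff_strongEpi_of_hasPullbacks _).1 hl
    have sq : CommSq (A.factorThru b hb) l A.arrow ((Subobject.pullback f).obj Q).arrow :=
      ⟨by simp [l]⟩
    exact Subobject.le_of_comm sq.lift sq.fac_right

end Regular

theorem comp_lift {E : Type u} [Category.{v} E] [HasPullbacks E] {T T' X Y Z : E} {a : X ⟶ Z}
    {b : Y ⟶ Z} (k : T' ⟶ T) (x : T ⟶ X) (y : T ⟶ Y) (h : x ≫ a = y ≫ b) :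
    k ≫ pullback.lift x y h = pullback.lift (k ≫ x) (k ≫ y) (by simp [h]) := by
  apply pullback.hom_ext <;> simp

theorem lift_congr {E : Type u} [Category.{v} E] [HasPullbacks E] {T X Y Z : E} {a : X ⟶ Z}
    {b : Y ⟶ Z} {x x' : T ⟶ X} {y y' : T ⟶ Y} (h : x ≫ a = y ≫ b) (hx : x = x') (hy : y = y') :
    pullback.lift x y h = pullback.lift x' y' (by rw [← hx, ← hy, h]) := by
  subst hx hy
  rfl

/-- Binary sums are stable under pullback. -/
theorem isColimit_of_isPullback {E : Type u} [Category.{v} E] [FinitaryPreExtensive E]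
    {X Y X' Y' Z : E} {c : BinaryCofan X Y} (hc : IsColimit c) {i : X' ⟶ Z} {j : Y' ⟶ Z}
    {f : Z ⟶ c.pt} {a : X' ⟶ X} {b : Y' ⟶ Y} (hi : IsPullback i a f c.inl)
    (hj : IsPullback j b f c.inr) : Nonempty (IsColimit (BinaryCofan.mk i j)) :=
  FinitaryPreExtensive.universal' c hc _ (mapPair a b) f
    (by ext ⟨⟨⟩⟩; exacts [hi.w.symm, hj.w.symm]) (NatTrans.Equifibered.of_discrete _)
    (by rintro ⟨⟨⟩⟩; exacts [hi, hj])

/-! ### Consequences of the axioms for small maps -/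

namespace IsClassOfSmallMaps

variable {E : Type u} [Category.{v} E] [PositiveHeyting E] {S : MorphismProperty E}

theorem respectsIso (hS : IsClassOfSmallMaps S) : S.RespectsIso :=
  MorphismProperty.RespectsIso.of_respects_arrow_iso _ fun f g e hf =>
    hS.pullback_stable (IsPullback.of_horiz_isIso ⟨e.inv.w⟩ :
      IsPullback e.inv.left g.hom f.hom e.inv.right) hf

theorem id_mem (hS : IsClassOfSmallMaps S) (X : E) : S (𝟙 X) :=
  hS.pullback_stable (IsPullback.of_vert_isIso ⟨by simp⟩ :
    IsPullback (terminal.from X) (𝟙 X) (𝟙 (⊤_ E)) (terminal.from X)) hS.one_small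

/-- A map is small as soon as its composite with some map is, because its graph is a pullback of a
diagonal. -/
theorem of_comp (hS : IsClassOfSmallMaps S) {X Y Z : E} (f : X ⟶ Y) (g : Y ⟶ Z) (h : S (f ≫ g)) :
    S f := by
  let l : X ⟶ pullback (f ≫ g) g := pullback.lift (𝟙 X) f (by simp)
  have hl : IsPullback f l (prod.lift (𝟙 Y) (𝟙 Y))
      (prod.lift (pullback.fst (f ≫ g) g ≫ f) (pullback.snd (f ≫ g) g)) := by
    refine ⟨⟨?_⟩, ⟨PullbackCone.IsLimit.mk _ (fun s => s.snd ≫ pullback.fst _ _) ?_ ?_ ?_⟩⟩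
    · ext <;> simp [l]
    · intro s
      have h : s.fst ≫ prod.lift (𝟙 Y) (𝟙 Y) = s.snd ≫ prod.lift _ _ := s.condition
      simpa using (h =≫ prod.fst).symm
    · intro s
      have h : s.fst ≫ prod.lift (𝟙 Y) (𝟙 Y) = s.snd ≫ prod.lift _ _ := s.condition
      apply pullback.hom_ext
      · simp [l]
      · have h₁ := h =≫ prod.fst
        have h₂ := h =≫ prod.snd
        simp only [Category.assoc, prod.lift_fst, prod.lift_snd, Category.comp_id] at h₁ h₂
        simp [l, ← h₁, ← h₂]
    · intro s m h₁ h₂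
      simp [← h₂, l]
  have hf : f = l ≫ pullback.snd (f ≫ g) g := by simp [l]
  rw [hf]
  exact hS.comp_small (hS.pullback_stable hl (hS.diagonals Y))
    (hS.pullback_stable (IsPullback.of_hasPullback (f ≫ g) g) h)

theorem of_isIso (hS : IsClassOfSmallMaps S) {X Y : E} (f : X ⟶ Y) [IsIso f] : S f :=
  hS.of_comp f (inv f) (by simpa using hS.id_mem X)

theorem initial_small (hS : IsClassOfSmallMaps S) {Z : E} (hZ : IsInitial Z) {W : E} (f : Z ⟶ W) :
    S f := by
  have h : IsPullback f (hZ.to (⊥_ E)) (terminal.from W) (initial.to (⊤_ E)) := by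
    refine ⟨⟨Subsingleton.elim _ _⟩,
      ⟨PullbackCone.IsLimit.mk _ (fun s => s.snd ≫ initial.to Z) (fun s => ?_) (fun s => ?_)
        (fun s m h₁ h₂ => ?_)⟩⟩
    all_goals exact (initialIsInitial.ofStrict s.snd).hom_ext _ _
  exact hS.pullback_stable h.flip hS.zero_small

/-- Codiagonals are small: `X ⨿ X ⟶ X` is a pullback of `1 ⨿ 1 ⟶ 1`. -/
theorem codiagonal_small (hS : IsClassOfSmallMaps S) (X : E) : S (coprod.desc (𝟙 X) (𝟙 X)) := by
  have hp (i : (⊤_ E) ⟶ (⊤_ E) ⨿ (⊤_ E)) :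
      IsPullback (prod.lift (𝟙 X) (terminal.from X ≫ i)) (terminal.from X) prod.snd i := by
    refine ⟨⟨by simp⟩, ⟨PullbackCone.IsLimit.mk _ (fun s => s.fst ≫ prod.fst) ?_ ?_ ?_⟩⟩
    · intro s
      ext
      · simp
      · simp [s.condition, ← Category.assoc, Subsingleton.elim (_ ≫ terminal.from X) s.snd]
    · intro s
      exact Subsingleton.elim _ _
    · intro s m h₁ h₂
      simp [← h₁]
  obtain ⟨hc⟩ := isColimit_of_isPullback (coprodIsCoprod (⊤_ E) (⊤_ E)) (hp _) (hp _)
  let e : X ⨿ X ≅ X ⨯ ((⊤_ E) ⨿ (⊤_ E)) := (coprodIsCoprod X X).coconePointUniqueUpToIso hc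
  have h₁ : coprod.inl ≫ e.hom = prod.lift (𝟙 X) (terminal.from X ≫ coprod.inl) :=
    (coprodIsCoprod X X).comp_coconePointUniqueUpToIso_hom hc ⟨.left⟩
  have h₂ : coprod.inr ≫ e.hom = prod.lift (𝟙 X) (terminal.from X ≫ coprod.inr) :=
    (coprodIsCoprod X X).comp_coconePointUniqueUpToIso_hom hc ⟨.right⟩
  have he : coprod.desc (𝟙 X) (𝟙 X) = e.hom ≫ prod.fst := by
    ext
    · simp [reassoc_of% h₁]
    · simp [reassoc_of% h₂]
  rw [he]
  refine hS.comp_small (hS.of_isIso _) (hS.pullback_stable (t := prod.snd)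
    (f := terminal.from ((⊤_ E) ⨿ (⊤_ E))) (p := terminal.from X) ?_ ?_)
  · exact (IsPullback.of_is_product (prodIsProd _ _) terminalIsTerminal).flip
  · rw [Subsingleton.elim (terminal.from ((⊤_ E) ⨿ (⊤_ E))) (coprod.desc (𝟙 _) (𝟙 _))]
    exact hS.two_small

end IsClassOfSmallMaps

/-! ### Generalized elements of internal presheaves -/

section Elements

variable {E : Type u} [Category.{v} E] [HasPullbacks E]

/-- The composite `f ∘ g` of generalized arrows of an internal category. -/
noncomputable def InternalCategory.compose (C : InternalCategory E) {T : E} (f g : T ⟶ C.C₁)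
    (h : f ≫ C.dom = g ≫ C.cod) : T ⟶ C.C₁ :=
  pullback.lift f g h ≫ C.comp

theorem InternalCategory.compose_congr (C : InternalCategory E) {T : E} {f f' g g' : T ⟶ C.C₁}
    (h : f ≫ C.dom = g ≫ C.cod) (hf : f = f') (hg : g = g') :
    C.compose f g h = C.compose f' g' (by rw [← hf, ← hg, h]) := by
  subst hf hg
  rfl

@[simp]
theorem InternalCategory.compose_cod (C : InternalCategory E) {T : E} (f g : T ⟶ C.C₁)
    (h : f ≫ C.dom = g ≫ C.cod) : C.compose f g h ≫ C.cod = f ≫ C.cod := by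
  simp [compose, C.comp_cod]

theorem InternalCategory.comp_compose (C : InternalCategory E) {T T' : E} (t : T' ⟶ T)
    (f g : T ⟶ C.C₁) (h : f ≫ C.dom = g ≫ C.cod) :
    t ≫ C.compose f g h = C.compose (t ≫ f) (t ≫ g) (by simp [h]) := by
  rw [compose, compose, ← Category.assoc]
  congr 1
  apply pullback.hom_ext <;> simp

attribute [simp] InternalCategory.ident_dom InternalCategory.ident_cod

theorem InternalCategory.ident_compose (C : InternalCategory E) {T : E} (i f : T ⟶ C.C₁)
    (hi : i = f ≫ C.cod ≫ C.ident) : C.compose i f (by simp [hi]) = f := by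
  subst hi
  exact C.ident_comp f

namespace Presheaf

variable {C : InternalCategory E}

/-- The restriction `x · f` of a generalized element `x` along a generalized arrow `f`. -/
noncomputable def res (X : Presheaf C) {T : E} (x : T ⟶ X.obj.left) (f : T ⟶ C.C₁)
    (h : x ≫ X.obj.hom = f ≫ C.cod) : T ⟶ X.obj.left :=
  pullback.lift x f h ≫ X.act

@[simp]
theorem res_hom (X : Presheaf C) {T : E} (x : T ⟶ X.obj.left) (f : T ⟶ C.C₁)
    (h : x ≫ X.obj.hom = f ≫ C.cod) : X.res x f h ≫ X.obj.hom = f ≫ C.dom := by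
  simp [res, X.act_hom]

theorem res_congr (X : Presheaf C) {T : E} {x x' : T ⟶ X.obj.left} {f f' : T ⟶ C.C₁}
    (h : x ≫ X.obj.hom = f ≫ C.cod) (hx : x = x') (hf : f = f') :
    X.res x f h = X.res x' f' (by rw [← hx, ← hf, h]) := by
  subst hx hf
  rfl

theorem comp_res (X : Presheaf C) {T T' : E} (t : T' ⟶ T) (x : T ⟶ X.obj.left) (f : T ⟶ C.C₁)
    (h : x ≫ X.obj.hom = f ≫ C.cod) :
    t ≫ X.res x f h = X.res (t ≫ x) (t ≫ f) (by simp [h]) := by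
  rw [res, res, ← Category.assoc]
  congr 1
  apply pullback.hom_ext <;> simp

theorem res_ident (X : Presheaf C) {T : E} (x : T ⟶ X.obj.left) (i : T ⟶ C.C₁)
    (hi : i = x ≫ X.obj.hom ≫ C.ident) : X.res x i (by simp [hi]) = x := by
  subst hi
  exact X.act_ident x

theorem res_res (X : Presheaf C) {T : E} (x : T ⟶ X.obj.left) (f g : T ⟶ C.C₁)
    (hf : x ≫ X.obj.hom = f ≫ C.cod) (hg : f ≫ C.dom = g ≫ C.cod) :
    X.res (X.res x f hf) g (by simpa using hg) = X.res x (C.compose f g hg) (by simpa using hf) :=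
  (X.act_comp x f g hf hg).symm

theorem act_eq_res (X : Presheaf C) : X.act = X.res (pullback.fst X.obj.hom C.cod)
    (pullback.snd X.obj.hom C.cod) pullback.condition := by
  have h : pullback.lift (pullback.fst X.obj.hom C.cod) (pullback.snd X.obj.hom C.cod)
      pullback.condition = 𝟙 _ := by
    apply pullback.hom_ext <;> simp
  rw [res, h, Category.id_comp]

theorem map_res {X Y : Presheaf C} (F : X ⟶ Y) {T : E} (x : T ⟶ X.obj.left) (f : T ⟶ C.C₁)
    (h : x ≫ X.obj.hom = f ≫ C.cod) :
    X.res x f h ≫ F.hom.left = Y.res (x ≫ F.hom.left) f (by simpa using h) :=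
  F.comm_apply x f h

@[simp]
theorem id_left (X : Presheaf C) : (𝟙 X : X ⟶ X).hom.left = 𝟙 X.obj.left := rfl

@[simp]
theorem comp_left {X Y Z : Presheaf C} (F : X ⟶ Y) (G : Y ⟶ Z) :
    (F ≫ G).hom.left = F.hom.left ≫ G.hom.left := rfl

theorem hom_ext {X Y : Presheaf C} {F G : X ⟶ Y} (h : F.hom.left = G.hom.left) : F = G :=
  Hom.ext (Over.OverMorphism.ext h)

/-- A map of presheaves, from a map of underlying objects that commutes with restriction of
generalized elements. -/
def mkHom {X Y : Presheaf C} (F : X.obj.left ⟶ Y.obj.left) (hF : F ≫ Y.obj.hom = X.obj.hom)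
    (h : ∀ {T : E} (x : T ⟶ X.obj.left) (f : T ⟶ C.C₁) (h : x ≫ X.obj.hom = f ≫ C.cod),
      X.res x f h ≫ F = Y.res (x ≫ F) f (by simpa [hF] using h)) : X ⟶ Y where
  hom := Over.homMk F hF
  comm := by
    rw [act_eq_res]
    exact h _ _ _

@[simp]
theorem mkHom_left {X Y : Presheaf C} (F : X.obj.left ⟶ Y.obj.left)
    (hF : F ≫ Y.obj.hom = X.obj.hom) (h) : (mkHom F hF h : X ⟶ Y).hom.left = F := rfl

variable (C) in
/-- The functor sending a presheaf to its underlying object of `E`. -/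
def carrier : Presheaf C ⥤ E := piStar C ⋙ Over.forget C.C₀

instance : (piStar C).Faithful where
  map_injective h := Hom.ext h

instance : (carrier C).Faithful where
  map_injective h := hom_ext h

instance : (carrier C).ReflectsIsomorphisms where
  reflects {X Y} F hF := by
    change IsIso F.hom.left at hF
    refine ⟨mkHom (inv F.hom.left) ?_ ?_, hom_ext ?_, hom_ext ?_⟩
    · simp
    · intro T x f h
      rw [← cancel_mono F.hom.left, Category.assoc, map_res]
      simp
    · simp
    · simp

/-- Elements of `π_! A` are pairs, restricted by composition in the second component. -/
theorem res_piShriek (A : Over C.C₀) {T : E} (x : T ⟶ A.left) (f g : T ⟶ C.C₁)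
    (hx : x ≫ A.hom = f ≫ C.cod) (h : f ≫ C.dom = g ≫ C.cod) :
    (piShriek A).res (pullback.lift x f hx) g (by simpa [piShriek] using h) =
      pullback.lift x (C.compose f g h) (by simpa using hx) :=
  lift_shriekAct A x f g hx (by simpa using h)

theorem transpose_left {B : Over C.C₀} {Y : Presheaf C} (u : B ⟶ Y.obj) :
    (transpose (Y := Y) u).hom.left =
      Y.res (pullback.fst B.hom C.cod ≫ u.left) (pullback.snd B.hom C.cod)
        (by simp [pullback.condition]) := rfl

theorem lift_transpose_left {B : Over C.C₀} {Y : Presheaf C} (u : B ⟶ Y.obj) {T : E}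
    (x : T ⟶ B.left) (f : T ⟶ C.C₁) (h : x ≫ B.hom = f ≫ C.cod) :
    pullback.lift x f h ≫ (transpose (Y := Y) u).hom.left =
      Y.res (x ≫ u.left) f (by simpa using h) := by
  rw [transpose_left, comp_res]
  exact res_congr _ _ (by simp) (by simp)

/-- The unit `a ↦ (a, id)` of the adjunction between `π_!` and `π^*`. -/
noncomputable def shriekUnit (A : Over C.C₀) : A ⟶ (piShriek A).obj :=
  pairMap (𝟙 A.left) (A.hom ≫ C.ident) (by simp) (by simp)

theorem comp_shriekUnit_left (A : Over C.C₀) {T : E} (x : T ⟶ A.left) :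
    x ≫ (shriekUnit A).left = pullback.lift x (x ≫ A.hom ≫ C.ident) (by simp) := by
  change x ≫ pullback.lift (𝟙 A.left) (A.hom ≫ C.ident) _ = _
  apply pullback.hom_ext <;> simp

theorem shriekUnit_transpose {B : Over C.C₀} {Y : Presheaf C} (u : B ⟶ Y.obj) :
    shriekUnit B ≫ (transpose (Y := Y) u).hom = u := by
  ext
  refine (lift_transpose_left u _ _ _).trans ?_
  rw [res_congr _ _ (Category.id_comp _) rfl]
  exact res_ident _ _ _ (by simp)

theorem transpose_shriekUnit {B : Over C.C₀} {Y : Presheaf C} (F : piShriek B ⟶ Y) :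
    transpose (Y := Y) (shriekUnit B ≫ F.hom) = F := by
  apply hom_ext
  have h := map_res F (pullback.lift (pullback.fst B.hom C.cod)
    (pullback.fst B.hom C.cod ≫ B.hom ≫ C.ident) (by simp)) (pullback.snd B.hom C.cod)
    (by simp [piShriek, pullback.condition])
  rw [res_piShriek B _ _ _ _ (by simp [pullback.condition])] at h
  refine (transpose_left (Y := Y) (shriekUnit B ≫ F.hom)).trans
    ((res_congr _ _ ?_ rfl).trans (h.symm.trans ?_))
  · refine (Category.assoc _ _ _).symm.trans (congrArg (· ≫ F.hom.left) ?_)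
    exact comp_shriekUnit_left _ _
  · refine (congrArg (· ≫ F.hom.left) (?_ : _ = 𝟙 (pullback B.hom C.cod))).trans
      (Category.id_comp _)
    apply pullback.hom_ext
    · simp
    · simp only [pullback.lift_snd, Category.id_comp]
      exact C.ident_compose _ _ (by simp [pullback.condition_assoc])

/-- The bijection of hom-sets for the adjunction between `π_!` and `π^*`: a map out of `π_! B` is
determined by its values at the pairs `(b, id)`. -/
noncomputable def shriekHomEquiv (B : Over C.C₀) (Y : Presheaf C) :
    (piShriek B ⟶ Y) ≃ (B ⟶ (piStar C).obj Y) where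
  toFun F := shriekUnit B ≫ (piStar C).map F
  invFun u := transpose u
  left_inv F := transpose_shriekUnit F
  right_inv u := shriekUnit_transpose (Y := Y) u

variable (C) in
/-- The functor `π_!`, whose action on maps is `(b, f) ↦ (u b, f)`. -/
noncomputable def shriek : Over C.C₀ ⥤ Presheaf C :=
  Adjunction.leftAdjointOfEquiv (G := piStar C) shriekHomEquiv
    (fun _ _ _ _ _ => ((congrArg _ ((piStar C).map_comp _ _)).trans (Category.assoc _ _ _).symm))

variable (C) in
/-- The adjunction between `π_!` and `π^*`. -/
noncomputable def shriekAdj : shriek C ⊣ piStar C :=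
  Adjunction.adjunctionOfEquivLeft _ _

theorem shriek_map_left {B A : Over C.C₀} (u : B ⟶ A) :
    ((shriek C).map u).hom.left =
      pullback.lift (pullback.fst B.hom C.cod ≫ u.left) (pullback.snd B.hom C.cod)
        (by simp [pullback.condition]) := by
  refine (transpose_left (Y := piShriek A) (u ≫ shriekUnit A ≫ 𝟙 _)).trans ?_
  rw [Category.comp_id]
  have h := comp_shriekUnit_left A (pullback.fst B.hom C.cod ≫ u.left)
  refine (res_congr (x' := pullback.lift (pullback.fst B.hom C.cod ≫ u.left) _ _) _ _
    ((Category.assoc _ _ _).symm.trans h) rfl).trans ?_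
  rw [res_piShriek _ _ _ _ _ (by simp [pullback.condition])]
  apply pullback.hom_ext
  · simp
  · simp only [pullback.lift_snd]
    exact C.ident_compose _ _ (by simp [pullback.condition_assoc])

theorem isPullback_shriek_map {B A : Over C.C₀} (u : B ⟶ A) :
    IsPullback ((shriek C).map u).hom.left (pullback.fst B.hom C.cod) (pullback.fst A.hom C.cod)
      u.left := by
  have h : IsPullback (pullback.snd B.hom C.cod) (pullback.fst B.hom C.cod) C.cod
    (u.left ≫ A.hom) := by
    simpa using (IsPullback.of_hasPullback B.hom C.cod).flip
  have h' : IsPullback (pullback.lift (pullback.fst B.hom C.cod ≫ u.left)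
      (pullback.snd B.hom C.cod) (by simp [pullback.condition])) (pullback.fst B.hom C.cod)
      (pullback.fst A.hom C.cod) u.left :=
    IsPullback.of_right (by simpa using h) (by simp) (IsPullback.of_hasPullback A.hom C.cod).flip
  rw [shriek_map_left]
  exact h'

theorem shriekAdj_unit (A : Over C.C₀) : (shriekAdj C).unit.app A = shriekUnit A := by
  simp only [shriekAdj, Adjunction.adjunctionOfEquivLeft]
  simp only [Adjunction.mkOfHomEquiv_unit_app]
  exact Category.comp_id (shriekUnit A)

theorem shriekAdj_counit_left (X : Presheaf C) :
    ((piStar C).map ((shriekAdj C).counit.app X)).left = X.act := by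
  have h : (shriekAdj C).counit.app X = transpose (Y := X) (𝟙 X.obj) := by
    simp only [shriekAdj, Adjunction.adjunctionOfEquivLeft]
    simp [shriekHomEquiv]
    rfl
  rw [h]
  refine (transpose_left (Y := X) _).trans ?_
  rw [act_eq_res]
  exact res_congr _ _ (by simp) rfl

end Presheaf
end Elements

/-! ### Limits and coproducts of internal presheaves -/

namespace Presheaf

section Monadicity

variable {E : Type u} [Category.{v} E] [HasPullbacks E] {C : InternalCategory E}

theorem comparison_a_left (X : Presheaf C) :
    ((Monad.comparison (shriekAdj C)).obj X).a.left = X.act :=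
  shriekAdj_counit_left X

instance : (Monad.comparison (shriekAdj C)).Full where
  map_surjective {X Y} g := by
    let g' : X.obj ⟶ Y.obj := g.f
    refine ⟨⟨g', ?_⟩, rfl⟩
    have h := congrArg (fun k => k.left) g.h
    change ((shriek C).map g').hom.left ≫ ((Monad.comparison (shriekAdj C)).obj Y).a.left =
      ((Monad.comparison (shriekAdj C)).obj X).a.left ≫ g'.left at h
    rw [comparison_a_left, comparison_a_left, shriek_map_left] at h
    exact h.symm

/-- The presheaf with the restriction operation given by the structure map of an algebra. -/
noncomputable def ofAlgebra (A : (shriekAdj C).toMonad.Algebra) : Presheaf C where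
  obj := A.A
  act := A.a.left
  act_hom := Over.w A.a
  act_ident {T} x := by
    have h : x ≫ ((shriekAdj C).unit.app A.A).left ≫ A.a.left = x ≫ 𝟙 _ :=
      congrArg (fun k => x ≫ k.left) A.unit
    rw [shriekAdj_unit] at h
    exact (congrArg (· ≫ A.a.left) (comp_shriekUnit_left A.A x).symm).trans
      ((Category.assoc _ _ _).trans (h.trans (Category.comp_id _)))
  act_comp {T} x f g hf hg := by
    obtain ⟨a, haA⟩ : ∃ a : pullback A.A.hom C.cod ⟶ A.A.left, a = A.a.left := ⟨_, rfl⟩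
    have ha : a ≫ A.A.hom = pullback.snd A.A.hom C.cod ≫ C.dom := by
      subst haA
      exact Over.w A.a
    have h : shriekAct A.A ≫ a =
        pullback.lift (pullback.fst (pullback.snd A.A.hom C.cod ≫ C.dom) C.cod ≫ a)
          (pullback.snd (pullback.snd A.A.hom C.cod ≫ C.dom) C.cod)
          (by simp [ha, pullback.condition]) ≫ a := by
      have h : ((piStar C).map ((shriekAdj C).counit.app (piShriek A.A))).left ≫ A.a.left =
        ((shriek C).map A.a).hom.left ≫ A.a.left := congrArg (fun k => k.left) A.assoc
      rw [shriekAdj_counit_left, shriek_map_left] at h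
      subst haA
      exact h
    have h' := congrArg (pullback.lift (pullback.lift x f hf) g (by simpa using hg) ≫ ·) h
    have h₁ := lift_shriekAct A.A x f g hf (by simpa using hg)
    simp only [← Category.assoc] at h'
    rw [h₁] at h'
    have h₂ : pullback.lift x (pullback.lift f g hg ≫ C.comp) (by simpa [C.comp_cod] using hf) ≫ a =
        pullback.lift (pullback.lift x f hf ≫ a) g (by simpa [ha] using hg) ≫ a := by
      refine h'.trans ?_
      congr 1
      apply pullback.hom_ext <;> simp
    subst haA
    exact h₂

instance : (Monad.comparison (shriekAdj C)).EssSurj where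
  mem_essImage A := ⟨ofAlgebra A, ⟨Monad.Algebra.isoMk (Iso.refl A.A) (by
    have h : ((Monad.comparison (shriekAdj C)).obj (ofAlgebra A)).a = A.a :=
      Over.OverMorphism.ext (comparison_a_left (ofAlgebra A))
    rw [h]
    exact (congrArg (· ≫ A.a) ((shriekAdj C).toMonad.map_id A.A)).trans
      ((Category.id_comp _).trans (Category.comp_id _).symm))⟩⟩

noncomputable instance : MonadicRightAdjoint (piStar C) where
  L := shriek C
  adj := shriekAdj C
  eqv := { }

end Monadicity

section

variable {E : Type u} [Category.{v} E] [Regular E] {C : InternalCategory E}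

instance : HasFiniteLimits (Presheaf C) where
  out J _ _ := by
    have := monadicCreatesLimits.{0, 0} (piStar C)
    exact hasLimitsOfShape_of_hasLimitsOfShape_createsLimitsOfShape (piStar C)

instance : PreservesLimitsOfShape WalkingCospan (carrier C) := by
  have := (shriekAdj C).rightAdjoint_preservesLimits.{0, 0}
  have : PreservesLimitsOfShape WalkingCospan (piStar C) := inferInstance
  unfold carrier
  infer_instance

instance : ReflectsLimitsOfShape WalkingCospan (carrier C) :=
  reflectsLimitsOfShape_of_reflectsIsomorphisms

theorem carrier_mono {X Y : Presheaf C} (F : X ⟶ Y) [Mono F] : Mono F.hom.left :=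
  inferInstanceAs (Mono ((carrier C).map F))

theorem mono_of_carrier {X Y : Presheaf C} (F : X ⟶ Y) [h : Mono F.hom.left] : Mono F := by
  have : Mono ((carrier C).map F) := h
  exact (carrier C).mono_of_mono_map this

end

section Coproducts

variable {E : Type u} [Category.{v} E] [Regular E] [FinitaryPreExtensive E]
  {C : InternalCategory E}

instance : PreservesColimitsOfShape (Discrete WalkingPair) (shriek C ⋙ piStar C) where
  preservesColimit {K} := by
    have key (X Y : Over C.C₀) : PreservesColimit (pair X Y)
        ((shriek C ⋙ piStar C) ⋙ Over.forget C.C₀) := by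
      refine preservesColimit_of_preserves_colimit_cocone (coprodIsCoprod X Y)
        ((isColimitMapCoconeBinaryCofanEquiv _ _ _).symm ?_)
      exact (isColimit_of_isPullback
        (isColimitMapCoconeBinaryCofanEquiv (Over.forget C.C₀) _ _
          (isColimitOfPreserves (Over.forget C.C₀) (coprodIsCoprod X Y)))
        (isPullback_shriek_map coprod.inl) (isPullback_shriek_map coprod.inr)).some
    have : PreservesColimit K ((shriek C ⋙ piStar C) ⋙ Over.forget C.C₀) :=
      preservesColimit_of_iso_diagram _ (diagramIsoPair K).symm
    exact preservesColimit_of_reflects_of_preserves _ (Over.forget C.C₀)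

instance : PreservesColimitsOfShape (Discrete PEmpty.{1}) (shriek C ⋙ piStar C) := by
  have : PreservesColimit (Functor.empty _) ((shriek C ⋙ piStar C) ⋙ Over.forget C.C₀) := by
    refine preservesColimit_of_preserves_colimit_cocone initialIsInitial
      ((isColimitMapCoconeEmptyCoconeEquiv _ _).symm ?_)
    exact IsInitial.ofStrict (pullback.fst (⊥_ (Over C.C₀)).hom C.cod)
      (IsInitial.isInitialObj (Over.forget C.C₀) _ initialIsInitial)
  have : PreservesColimitsOfShape (Discrete PEmpty.{1})
      ((shriek C ⋙ piStar C) ⋙ Over.forget C.C₀) :=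
    preservesColimitsOfShape_pempty_of_preservesInitial _
  exact ⟨fun {K} => preservesColimit_of_reflects_of_preserves _ (Over.forget C.C₀)⟩

noncomputable instance (J : Type) [Category J]
    [PreservesColimitsOfShape J (shriek C ⋙ piStar C)] :
    CreatesColimitsOfShape J (piStar C) where
  CreatesColimit {K} := by
    have : PreservesColimitsOfShape J (monadicLeftAdjoint (piStar C) ⋙ piStar C) :=
      inferInstanceAs (PreservesColimitsOfShape J (shriek C ⋙ piStar C))
    exact monadicCreatesColimitOfPreservesColimit _ K

instance : HasFiniteCoproducts (Presheaf C) := by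
  have : HasInitial (Presheaf C) :=
    hasColimitsOfShape_of_hasColimitsOfShape_createsColimitsOfShape (piStar C)
  have : HasBinaryCoproducts (Presheaf C) :=
    hasColimitsOfShape_of_hasColimitsOfShape_createsColimitsOfShape (piStar C)
  exact hasFiniteCoproducts_of_has_binary_and_initial

instance : PreservesColimitsOfShape (Discrete WalkingPair) (carrier C) := by
  have : PreservesColimitsOfShape (Discrete WalkingPair) (piStar C) := inferInstance
  unfold carrier
  infer_instance

instance : PreservesColimitsOfShape (Discrete PEmpty.{1}) (carrier C) := by
  have : PreservesColimitsOfShape (Discrete PEmpty.{1}) (piStar C) := inferInstance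
  unfold carrier
  infer_instance

instance : ReflectsColimitsOfShape (Discrete WalkingPair) (carrier C) :=
  reflectsColimitsOfShape_of_reflectsIsomorphisms

theorem isInitial_carrier {X : Presheaf C} (h : IsInitial X) : Nonempty (IsInitial X.obj.left) :=
  ⟨IsInitial.isInitialObj (carrier C) X h⟩

theorem isInitial_of_carrier {X : Presheaf C} (h : IsInitial X.obj.left) :
    Nonempty (IsInitial X) := by
  have : IsIso ((carrier C).map (initial.to X)) :=
    ⟨h.to _, (IsInitial.isInitialObj (carrier C) _ initialIsInitial).hom_ext _ _, h.hom_ext _ _⟩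
  have := isIso_of_reflects_iso (initial.to X) (carrier C)
  exact ⟨initialIsInitial.ofIso (asIso (initial.to X))⟩

instance : FinitaryPreExtensive (Presheaf C) where
  universal' {X Y} c hc := by
    refine IsUniversalColimit.of_mapCocone (carrier C) ?_
    let i := diagramIsoPair (pair X Y ⋙ carrier C)
    have hu : IsUniversalColimit ((Cocone.precompose i.inv).obj ((carrier C).mapCocone c)) :=
      FinitaryPreExtensive.universal' _
        ((IsColimit.precomposeInvEquiv i _).symm (isColimitOfPreserves (carrier C) hc))
    exact (hu.precompose_isIso i.hom).of_iso (Cocone.ext (Iso.refl _) fun j =>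
      (Category.comp_id _).trans (i.hom_inv_id_app_assoc j _))

instance [BinaryCoproductsDisjoint E] : BinaryCoproductsDisjoint (Presheaf C) :=
  BinaryCoproductsDisjoint.mk fun X Y => by
    have hc := isColimitMapCoconeBinaryCofanEquiv (carrier C) _ _
          (isColimitOfPreserves (carrier C) (coprodIsCoprod X Y))
    have : Mono (coprod.inl : X ⟶ X ⨿ Y).hom.left :=
      Mono.of_binaryCoproductDisjoint_left _ hc
    have := mono_of_carrier (coprod.inl : X ⟶ X ⨿ Y)
    have : Mono (coprod.inr : Y ⟶ X ⨿ Y).hom.left :=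
      Mono.of_binaryCoproductDisjoint_right _ hc
    have := mono_of_carrier (coprod.inr : Y ⟶ X ⨿ Y)
    have h := (IsPullback.of_hasPullback (coprod.inl : X ⟶ X ⨿ Y) coprod.inr)
    obtain ⟨hi⟩ := isInitial_of_carrier (IsInitial.ofBinaryCoproductDisjointOfIsColimitOfIsLimit hc
      (h.map (carrier C)).isLimit)
    have : Mono (BinaryCofan.mk (coprod.inl : X ⟶ X ⨿ Y) coprod.inr).inl := ‹Mono coprod.inl›
    have : Mono (BinaryCofan.mk (coprod.inl : X ⟶ X ⨿ Y) coprod.inr).inr := ‹Mono coprod.inr›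
    exact BinaryCoproductDisjoint.of_binaryCofan (coprodIsCoprod X Y) h.isLimit hi

end Coproducts
end Presheaf

/-! ### Images and covers of internal presheaves -/

namespace Presheaf

section

variable {E : Type u} [Category.{v} E] [HasPullbacks E] {C : InternalCategory E}

/-- The subpresheaf of `X` on a subobject `i` of its underlying object which is closed under
restriction. -/
noncomputable def sub (X : Presheaf C) {I : E} (i : I ⟶ X.obj.left) [Mono i]
    (a : pullback (i ≫ X.obj.hom) C.cod ⟶ I)
    (ha : a ≫ i = X.res (pullback.fst (i ≫ X.obj.hom) C.cod ≫ i)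
      (pullback.snd (i ≫ X.obj.hom) C.cod) (by simp [pullback.condition])) : Presheaf C :=
  have key {T : E} (x : T ⟶ I) (f : T ⟶ C.C₁) (h : x ≫ i ≫ X.obj.hom = f ≫ C.cod) :
      (pullback.lift x f h ≫ a) ≫ i = X.res (x ≫ i) f (by simpa using h) := by
    rw [Category.assoc, ha, comp_res]
    exact res_congr _ _ (by simp) (by simp)
  { obj := Over.mk (i ≫ X.obj.hom)
    act := a
    act_hom := by
      change a ≫ i ≫ X.obj.hom = _
      rw [← Category.assoc, ha]
      simp
    act_ident {T} x := by
      change T ⟶ I at x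
      change pullback.lift x (x ≫ (i ≫ X.obj.hom) ≫ C.ident) _ ≫ a = x
      rw [← cancel_mono i, key]
      exact X.res_ident _ _ (by simp)
    act_comp {T} x f g hf hg := by
      change T ⟶ I at x
      change x ≫ i ≫ X.obj.hom = _ at hf
      change pullback.lift x (C.compose f g hg) _ ≫ a =
        pullback.lift (pullback.lift x f hf ≫ a) g _ ≫ a
      rw [← cancel_mono i, key _ _ (by simpa using hf), key _ _ (by
        rw [← Category.assoc, key]
        simpa using hg), res_congr _ _ (key _ _ _) rfl]
      exact (X.res_res _ _ _ _ _).symm }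

/-- The inclusion of a subpresheaf. -/
noncomputable def subι (X : Presheaf C) {I : E} (i : I ⟶ X.obj.left) [Mono i]
    (a : pullback (i ≫ X.obj.hom) C.cod ⟶ I)
    (ha : a ≫ i = X.res (pullback.fst (i ≫ X.obj.hom) C.cod ≫ i)
      (pullback.snd (i ≫ X.obj.hom) C.cod) (by simp [pullback.condition])) : X.sub i a ha ⟶ X where
  hom := Over.homMk i rfl
  comm := ha

/-- Factorizations of the underlying map through a subpresheaf are maps of presheaves. -/
theorem exists_lift {X Y A : Presheaf C} (F : Y ⟶ X) (M : A ⟶ X) [Mono M.hom.left]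
    (k : Y.obj.left ⟶ A.obj.left) (hk : k ≫ M.hom.left = F.hom.left) :
    ∃ K : Y ⟶ A, K ≫ M = F ∧ K.hom.left = k := by
  refine ⟨mkHom k ?_ ?_, hom_ext hk, rfl⟩
  · rw [← Over.w M.hom, ← Category.assoc, hk, Over.w]
  · intro T x f h
    rw [← cancel_mono M.hom.left, map_res, Category.assoc]
    refine (congrArg (Y.res x f h ≫ ·) hk).trans ((map_res F x f h).trans ?_)
    exact res_congr _ _ (by simp [hk]) rfl

/-- A map of presheaves can be descended along a map `F` whose underlying map is a cover. -/
theorem exists_desc_of_extremalEpi {E : Type u} [Category.{v} E] [Regular E]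
    {C : InternalCategory E} {X Y Z : Presheaf C} (F : Y ⟶ X) [ExtremalEpi F.hom.left] (k : Y ⟶ Z)
    (l : X.obj.left ⟶ Z.obj.left) (hl : F.hom.left ≫ l = k.hom.left) :
    ∃ L : X ⟶ Z, L.hom.left = l := by
  refine ⟨mkHom l ?_ ?_, rfl⟩
  · rw [← cancel_epi F.hom.left, ← Category.assoc, hl, Over.w, Over.w]
  · intro T x f h
    -- After passing to a cover of `T`, the element `x` lifts along `F`.
    let t := pullback.fst x F.hom.left
    let y := pullback.snd x F.hom.left
    have ht : t ≫ x = y ≫ F.hom.left := pullback.condition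
    have : ExtremalEpi t :=
      extremalEpi_of_isPullback (IsPullback.of_hasPullback x F.hom.left).flip inferInstance
    have h₁ : (t ≫ x) ≫ l = y ≫ k.hom.left := by rw [ht, Category.assoc, hl]
    have hy : y ≫ Y.obj.hom = (t ≫ f) ≫ C.cod := by
      rw [← Over.w F.hom, ← Category.assoc, ← ht, Category.assoc, h, Category.assoc]
    rw [← cancel_epi t, ← Category.assoc, comp_res, comp_res,
      res_congr _ _ ht rfl, ← map_res F y (t ≫ f) hy, Category.assoc]
    refine (congrArg (Y.res y (t ≫ f) hy ≫ ·) hl).trans ((map_res k y _ hy).trans ?_)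
    exact res_congr _ _ (by rw [← h₁, Category.assoc]) rfl

end

section

variable {E : Type u} [Category.{v} E] [Regular E] {C : InternalCategory E}

theorem exists_image {X Y : Presheaf C} (F : Y ⟶ X) :
    ∃ (I : Presheaf C) (e : Y ⟶ I) (m : I ⟶ X),
      e ≫ m = F ∧ Mono m ∧ ExtremalEpi e.hom.left := by
  let fac := Regular.strongEpiMonoFactorisation F.hom.left
  have : IsRegularEpi fac.e :=
    inferInstanceAs (IsRegularEpi (Regular.strongEpiMonoFactorisation F.hom.left).e)
  have : Mono fac.m := fac.m_mono
  let i : fac.I ⟶ X.obj.left := fac.m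
  have hi : fac.e ≫ i = F.hom.left := fac.fac
  -- The image is closed under restriction since covers are stable under pullback.
  let q : pullback Y.obj.hom C.cod ⟶ pullback (i ≫ X.obj.hom) C.cod :=
    pullback.lift (pullback.fst _ _ ≫ fac.e) (pullback.snd _ _)
      (by simp [reassoc_of% hi, pullback.condition])
  have hq : IsPullback (pullback.fst Y.obj.hom C.cod) q fac.e (pullback.fst _ _) := by
    refine IsPullback.flip (IsPullback.of_right (h₁₂ := pullback.snd _ _) (v₁₃ := C.cod)
      (h₂₂ := i ≫ X.obj.hom) ?_ (by simp [q]) (IsPullback.of_hasPullback _ _).flip)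
    simpa [q, reassoc_of% hi] using (IsPullback.of_hasPullback Y.obj.hom C.cod).flip
  have : StrongEpi q := (extremalEpi_iff_strongEpi_of_hasPullbacks _).1
    (extremalEpi_of_isPullback hq inferInstance)
  have sq : CommSq (Y.act ≫ fac.e) q i
      (X.res (pullback.fst (i ≫ X.obj.hom) C.cod ≫ i) (pullback.snd (i ≫ X.obj.hom) C.cod)
        (by simp [pullback.condition])) := ⟨by
    rw [Category.assoc, hi, act_eq_res, map_res, comp_res]
    exact res_congr _ _ (by simp [q, hi]) (by simp [q])⟩
  have hm : Mono (X.subι i sq.lift sq.fac_right) := by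
    have : Mono (X.subι i sq.lift sq.fac_right).hom.left := ‹Mono fac.m›
    exact mono_of_carrier _
  have := carrier_mono (X.subι i sq.lift sq.fac_right)
  obtain ⟨e, he, he'⟩ := exists_lift F (X.subι i sq.lift sq.fac_right) fac.e hi
  refine ⟨_, e, _, he, hm, ?_⟩
  rw [he']
  exact inferInstanceAs (ExtremalEpi fac.e)

theorem isRegularEpi_of_carrier {X Y : Presheaf C} (F : Y ⟶ X) [ExtremalEpi F.hom.left] :
    IsRegularEpi F := by
  have hF : Epi F := (carrier C).epi_of_epi_map (inferInstanceAs (Epi F.hom.left))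
  have h : IsKernelPair F.hom.left (pullback.fst F F).hom.left (pullback.snd F F).hom.left :=
    (IsKernelPair.of_hasPullback F).map (carrier C)
  have hc := IsKernelPair.toCoequalizer' h
  -- The quotient map in `E` of the kernel pair of `F` is a map of presheaves.
  have hL {Z : Presheaf C} (k : Y ⟶ Z) (hk : pullback.fst F F ≫ k = pullback.snd F F ≫ k) :
      ∃ L : X ⟶ Z, F ≫ L = k := by
    obtain ⟨l, hl⟩ := Cofork.IsColimit.desc' hc k.hom.left (congrArg (fun G => G.hom.left) hk)
    obtain ⟨L, rfl⟩ := exists_desc_of_extremalEpi F k l hl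
    exact ⟨L, hom_ext hl⟩
  exact ⟨⟨{ W := pullback F F, left := pullback.fst F F, right := pullback.snd F F
            w := pullback.condition
            isColimit := Cofork.IsColimit.mk _ (fun s => (hL s.π s.condition).choose)
              (fun s => (hL s.π s.condition).choose_spec)
              (fun s m hm => by
                rw [← cancel_epi F, (hL s.π s.condition).choose_spec]
                exact hm) }⟩⟩

theorem extremalEpi_iff {X Y : Presheaf C} (F : Y ⟶ X) :
    ExtremalEpi F ↔ ExtremalEpi F.hom.left := by
  constructor
  · intro hF
    obtain ⟨I, e, m, rfl, _, he⟩ := exists_image F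
    have := hF.isIso e m rfl
    have : IsIso m.hom.left := inferInstanceAs (IsIso ((carrier C).map m))
    exact extremalEpi_comp he inferInstance
  · intro hF
    have := isRegularEpi_of_carrier F
    infer_instance

instance : Regular (Presheaf C) where
  hasCoequalizer_of_isKernelPair {X Y Z f g₁ g₂} h := by
    obtain ⟨I, e, m, rfl, _, he⟩ := exists_image f
    have := isRegularEpi_of_carrier e
    have h' : IsKernelPair e g₁ g₂ := h.cancel_right_of_mono
    exact ⟨⟨_, h'.toCoequalizer'⟩⟩
  regularEpiIsStableUnderBaseChange := by
    refine ⟨fun {X Y Y' S f g f' g'} h hg => ?_⟩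
    have hg : IsRegularEpi g := hg
    have : ExtremalEpi g'.hom.left := extremalEpi_of_isPullback (h.map (carrier C))
      ((extremalEpi_iff g).1 inferInstance)
    exact isRegularEpi_of_carrier g'

end

end Presheaf

/-! ### Universal quantification along maps of internal presheaves -/

namespace Presheaf

variable {E : Type u} [Category.{v} E]

/-- The universal quantification of a subpresheaf `A` along a map `F` of presheaves: `x` belongs to
it if and only if `A` contains the fibres of `F` over all restrictions of `x`. Since these
restrictions are indexed by a pullback of the codomain map of the internal category, it is small if
that map, `F` and `A` are. -/
theorem exists_forall_obj [PositiveHeyting E] {C : InternalCategory E} {X Y : Presheaf C}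
    (F : Y ⟶ X) (A : Subobject Y) :
    ∃ B : Subobject X, (∀ Q : Subobject X, (Subobject.pullback F).obj Q ≤ A ↔ Q ≤ B) ∧
      ∀ S : MorphismProperty E, IsClassOfSmallMaps S → S C.cod → S F.hom.left →
        S A.arrow.hom.left → S B.arrow.hom.left := by
  have hA : Mono A.arrow.hom.left := carrier_mono A.arrow
  let A' := Subobject.mk A.arrow.hom.left
  obtain ⟨R, hR⟩ := PositiveHeyting.exists_forall F.hom.left
  obtain ⟨R', hR'⟩ := PositiveHeyting.exists_forall (pullback.fst X.obj.hom C.cod)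
  let D := R A'
  let D' := (Subobject.pullback X.act).obj D
  let J := R' D'
  have hJ {T : E} (x : T ⟶ X.obj.left) : J.Factors x ↔
      ∀ {T' : E} (t : T' ⟶ T) (f : T' ⟶ C.C₁) (y : T' ⟶ Y.obj.left)
        (h : (t ≫ x) ≫ X.obj.hom = f ≫ C.cod), y ≫ F.hom.left = X.res (t ≫ x) f h →
          A'.Factors y := by
    let b : pullback (x ≫ X.obj.hom) C.cod ⟶ pullback X.obj.hom C.cod :=
      pullback.lift (pullback.fst _ _ ≫ x) (pullback.snd _ _) (by simp [pullback.condition])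
    have hb : IsPullback b (pullback.fst _ _) (pullback.fst X.obj.hom C.cod) x := by
      refine IsPullback.of_right (h₁₂ := pullback.snd _ _) (v₁₃ := C.cod)
        (h₂₂ := X.obj.hom) ?_ (by simp [b]) (IsPullback.of_hasPullback _ _).flip
      simpa [b] using (IsPullback.of_hasPullback (x ≫ X.obj.hom) C.cod).flip
    rw [forall_factors_iff hR' D' hb, Limits.pullback_factors_iff,
      forall_factors_iff hR A' (IsPullback.of_hasPullback _ _)]
    have hact : b ≫ X.act = X.res (pullback.fst _ _ ≫ x) (pullback.snd _ _)
        (by simp [pullback.condition]) := rfl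
    constructor
    · intro h T' t f y h' hy
      let l : T' ⟶ pullback F.hom.left (b ≫ X.act) := pullback.lift y
        (pullback.lift t f (by simpa using h')) (by
          rw [hy, hact, comp_res]
          exact res_congr _ _ (by simp) (by simp))
      have hl : l ≫ pullback.fst _ _ = y := pullback.lift_fst _ _ _
      rw [← hl]
      exact Subobject.factors_of_factors_right _ h
    · intro h
      refine h (pullback.snd _ _ ≫ pullback.fst _ _) (pullback.snd _ _ ≫ pullback.snd _ _) _
        (by simp [pullback.condition]) ?_
      refine pullback.condition.trans ((comp_res X _ (pullback.fst (x ≫ X.obj.hom) C.cod ≫ x)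
        (pullback.snd _ _) (by simp [pullback.condition])).trans ?_)
      exact res_congr _ _ (by simp) rfl
  have hJa : J.Factors (X.res (pullback.fst (J.arrow ≫ X.obj.hom) C.cod ≫ J.arrow)
      (pullback.snd (J.arrow ≫ X.obj.hom) C.cod) (by simp [pullback.condition])) := by
    rw [hJ]
    intro T' t f y h hy
    have hf : (t ≫ pullback.snd (J.arrow ≫ X.obj.hom) C.cod) ≫ C.dom = f ≫ C.cod := by
      rw [← h]
      simp
    refine (hJ J.arrow).1 (Subobject.factors_self J) (t ≫ pullback.fst _ _)
      (C.compose (t ≫ pullback.snd _ _) f hf) y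
      (by simp [pullback.condition]) ?_
    rw [hy, res_congr _ h (comp_res _ _ _ _ _) rfl, res_res _ _ _ _ _ hf]
    exact res_congr _ _ (by simp) rfl
  let ι := X.subι J.arrow (J.factorThru _ hJa) (by simp)
  have hι : Mono ι.hom.left := inferInstanceAs (Mono J.arrow)
  have : Mono ι := mono_of_carrier ι
  refine ⟨Subobject.mk ι, fun Q => ?_, fun S hS hcod hF hA => ?_⟩
  · have h₁ : Q ≤ Subobject.mk ι ↔ J.Factors Q.arrow.hom.left := by
      constructor
      · intro h
        have h' : (Subobject.ofLEMk Q ι h).hom.left ≫ J.arrow = Q.arrow.hom.left :=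
          congrArg (fun G => G.hom.left) (Subobject.ofLEMk_comp h)
        rw [← h']
        exact Subobject.factors_comp_arrow _
      · intro h
        obtain ⟨K, hK, -⟩ := exists_lift Q.arrow ι (J.factorThru _ h) (J.factorThru_arrow _ h)
        exact Subobject.le_mk_of_comm K hK
    have hP := Subobject.isPullback F Q
    let P := (Subobject.pullback F).obj Q
    rw [h₁, hJ]
    constructor
    · intro h T' t f y h' hy
      have h'' : t ≫ (Q : Presheaf C).obj.hom = f ≫ C.cod := by
        rw [← h', Category.assoc, Over.w]
      have hPc := hP.map (carrier C)
      let z : T' ⟶ (P : Presheaf C).obj.left := hPc.lift (Presheaf.res _ t f h'') y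
        ((map_res Q.arrow t f h'').trans hy.symm)
      have hz : z ≫ P.arrow.hom.left = y := hPc.lift_snd _ _ _
      have hPA : (Subobject.ofLE P A h).hom.left ≫ A.arrow.hom.left = P.arrow.hom.left :=
        congrArg (fun G => G.hom.left) (Subobject.ofLE_arrow h)
      rw [← hz, ← hPA]
      exact Subobject.factors_of_factors_right _
        (Subobject.factors_of_factors_right _ (Subobject.mk_factors_self _))
    · intro h
      have hf : A'.Factors P.arrow.hom.left := by
        refine h (Subobject.pullbackπ F Q).hom.left ((P : Presheaf C).obj.hom ≫ C.ident) _ ?_ ?_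
        · simp [P]
        · refine Eq.trans ?_ (res_ident _ _ _ ?_).symm
          · exact (congrArg (fun G => G.hom.left) hP.w).symm
          · simp [P]
      let k := A'.factorThru _ hf ≫ (Subobject.underlyingIso A.arrow.hom.left).hom
      have hk : k ≫ A.arrow.hom.left = P.arrow.hom.left := by
        simp only [k, Category.assoc, Subobject.underlyingIso_hom_comp_eq_mk]
        exact Subobject.factorThru_arrow _ _ hf
      obtain ⟨K, hK, -⟩ := exists_lift P.arrow A.arrow k hk
      exact Subobject.le_of_comm K hK
  · have h₁ : S A'.arrow := by
      rw [← Subobject.underlyingIso_hom_comp_eq_mk]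
      exact hS.comp_small (hS.of_isIso _) hA
    have h₂ : S D.arrow := hS.heyting _ R hF hR _ h₁
    have h₃ : S D'.arrow := hS.pullback_stable (Subobject.isPullback X.act D) h₂
    have h₄ : S J.arrow := hS.heyting _ R'
      (hS.pullback_stable (IsPullback.of_hasPullback X.obj.hom C.cod).flip hcod) hR' _ h₃
    rw [← Subobject.underlyingIso_hom_comp_eq_mk ι]
    have : IsIso (Subobject.underlyingIso ι).hom.hom.left :=
      inferInstanceAs (IsIso ((carrier C).map (Subobject.underlyingIso ι).hom))
    exact hS.comp_small (hS.of_isIso _) h₄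

instance [PositiveHeyting E] {C : InternalCategory E} : PositiveHeyting (Presheaf C) where
  exists_forall F := by
    choose R hR using fun A => exists_forall_obj F A
    exact ⟨R, fun Q A => (hR A).1 Q⟩

end Presheaf

/-! ### Pointwise small maps of internal presheaves -/

namespace Presheaf

variable {E : Type u} [Category.{v} E]

theorem pointwiseSmall_iff [HasPullbacks E] {C : InternalCategory E} {S : MorphismProperty E}
    {X Y : Presheaf C} (F : Y ⟶ X) : pointwiseSmall C S F ↔ S F.hom.left := Iff.rfl

/-- The axioms for classes of small maps other than collection hold for pointwise small maps of
presheaves, because they are detected by the underlying maps. -/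
theorem isClassOfSmallMaps_pointwiseSmall [PositiveHeyting E] {S : MorphismProperty E}
    (hS : IsClassOfSmallMaps S) {C : InternalCategory E} (hC : S C.cod)
    (hcoll : Collection (pointwiseSmall C S)) : IsClassOfSmallMaps (pointwiseSmall C S) where
  pullback_stable h hf := hS.pullback_stable (h.map (carrier C)) hf
  descent h hp hg := hS.descent (h.map (carrier C)) ((extremalEpi_iff _).1 hp) hg
  sums {X Y X' Y' f f'} hf hf' := by
    have := hS.respectsIso
    have e : Arrow.mk ((carrier C).map (coprod.map f f')) ≅
        Arrow.mk (coprod.map ((carrier C).map f) ((carrier C).map f')) :=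
      Arrow.isoMk (PreservesColimitPair.iso (carrier C) X X').symm
        (PreservesColimitPair.iso (carrier C) Y Y').symm (by
          change (PreservesColimitPair.iso (carrier C) X X').inv ≫ coprod.map _ _ =
            (carrier C).map (coprod.map f f') ≫ (PreservesColimitPair.iso (carrier C) Y Y').inv
          rw [Iso.inv_comp_eq, ← Category.assoc, Iso.eq_comp_inv, PreservesColimitPair.iso_hom,
            PreservesColimitPair.iso_hom, coprodComparison_natural])
    exact (S.arrow_mk_iso_iff e).2 (hS.sums hf hf')
  zero_small := hS.initial_small (isInitial_carrier initialIsInitial).some _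
  one_small := hS.id_mem _
  two_small := by
    let i := PreservesColimitPair.iso (carrier C) (⊤_ (Presheaf C)) (⊤_ (Presheaf C))
    have e : (carrier C).map (coprod.desc (𝟙 (⊤_ (Presheaf C))) (𝟙 (⊤_ (Presheaf C)))) =
        i.inv ≫ coprod.desc (𝟙 ((carrier C).obj (⊤_ (Presheaf C)))) (𝟙 _) := by
      rw [Iso.eq_inv_comp, PreservesColimitPair.iso_hom, coprodComparison,
        coprod.desc_comp, ← Functor.map_comp, ← Functor.map_comp, coprod.inl_desc, coprod.inr_desc,
        CategoryTheory.Functor.map_id]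
    have h : S ((carrier C).map (coprod.desc (𝟙 (⊤_ (Presheaf C))) (𝟙 (⊤_ (Presheaf C))))) := by
      rw [e]
      exact hS.comp_small (hS.of_isIso _) (hS.codiagonal_small _)
    exact h
  comp_small hf hg := hS.comp_small hf hg
  quotients hf hfg := hS.quotients ((extremalEpi_iff _).1 hf) hfg
  collection := hcoll
  heyting F R hF hR A hA := by
    obtain ⟨B, hB, hB'⟩ := exists_forall_obj F A
    have : R A = B := eq_of_forall_le_iff fun Q => (hR Q A).symm.trans (hB Q)
    rw [this]
    exact hB' S hS hC hF hA
  diagonals X := by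
    refine hS.of_comp _ (prod.fst : X ⨯ X ⟶ X).hom.left ?_
    have h : prod.lift (𝟙 X) (𝟙 X) ≫ prod.fst = 𝟙 X := prod.lift_fst _ _
    have h' : S (prod.lift (𝟙 X) (𝟙 X) ≫ (prod.fst : X ⨯ X ⟶ X)).hom.left := by
      rw [h]
      exact hS.id_mem _
    exact h'

end Presheaf

/-! ### The maps `(r, s)_!` -/

namespace Presheaf

section

variable {E : Type u} [Category.{v} E] [HasPullbacks E] {C : InternalCategory E}

theorem shriekMap_left {B A : Over C.C₀} (r : B.left ⟶ A.left) (s : B.left ⟶ C.C₁)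
    (hdom : s ≫ C.dom = B.hom) (hcod : s ≫ C.cod = r ≫ A.hom) :
    (shriekMap r s hdom hcod).hom.left =
      pullback.lift (pullback.fst B.hom C.cod ≫ r)
        (C.compose (pullback.fst B.hom C.cod ≫ s) (pullback.snd B.hom C.cod)
          (by simp [hdom, pullback.condition])) (by simp [hcod]) := by
  have h : pullback.fst B.hom C.cod ≫ (pairMap r s hdom hcod).left =
      pullback.lift (pullback.fst B.hom C.cod ≫ r) (pullback.fst B.hom C.cod ≫ s)
        (by simp [hcod]) := by
    change pullback.fst B.hom C.cod ≫ pullback.lift r s hcod.symm = _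
    apply pullback.hom_ext <;> simp
  refine (transpose_left (Y := piShriek A) (pairMap r s hdom hcod)).trans ?_
  refine (res_congr _ _ h rfl).trans ?_
  exact res_piShriek _ _ _ _ _ _

theorem lift_shriekMap_left {B A : Over C.C₀} (r : B.left ⟶ A.left) (s : B.left ⟶ C.C₁)
    (hdom : s ≫ C.dom = B.hom) (hcod : s ≫ C.cod = r ≫ A.hom) {T : E} (x : T ⟶ B.left)
    (f : T ⟶ C.C₁) (h : x ≫ B.hom = f ≫ C.cod) :
    pullback.lift x f h ≫ (shriekMap r s hdom hcod).hom.left =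
      pullback.lift (x ≫ r) (C.compose (x ≫ s) f (by simp [hdom, h])) (by simp [hcod]) := by
  rw [shriekMap_left]
  refine (comp_lift _ _ _ _).trans (lift_congr _ (by simp) ?_)
  simp [C.comp_compose]

theorem lift_shriek_map_left {B A : Over C.C₀} (u : B ⟶ A) {T : E} (x : T ⟶ B.left)
    (f : T ⟶ C.C₁) (h : x ≫ B.hom = f ≫ C.cod) :
    pullback.lift x f h ≫ ((shriek C).map u).hom.left =
      pullback.lift (x ≫ u.left) f (by simpa using h) := by
  rw [shriek_map_left]
  exact (comp_lift _ _ _ _).trans (lift_congr _ (by simp) (by simp))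

theorem shriekMap_congr {B A : Over C.C₀} {r r' : B.left ⟶ A.left} {s s' : B.left ⟶ C.C₁}
    (hdom : s ≫ C.dom = B.hom) (hcod : s ≫ C.cod = r ≫ A.hom) (hr : r = r') (hs : s = s') :
    shriekMap r s hdom hcod =
      shriekMap r' s' (by rw [← hs, hdom]) (by rw [← hr, ← hs, hcod]) := by
  subst hr hs
  rfl

/-- Maps out of `π_! B` are determined by their transposes. -/
theorem shriek_hom_ext {B : Over C.C₀} {Y : Presheaf C} {F G : (shriek C).obj B ⟶ Y}
    (h : shriekUnit B ≫ F.hom = shriekUnit B ≫ G.hom) : F = G :=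
  (shriekHomEquiv B Y).injective h

theorem shriekUnit_shriek_map {B A : Over C.C₀} (u : B ⟶ A) :
    shriekUnit B ≫ ((shriek C).map u).hom = u ≫ shriekUnit A := by
  rw [← shriekAdj_unit, ← shriekAdj_unit]
  exact ((shriekAdj C).unit.naturality u).symm

theorem shriek_map_shriekMap {Z B A : Over C.C₀} (t : Z ⟶ B) (r : B.left ⟶ A.left)
    (s : B.left ⟶ C.C₁) (hdom : s ≫ C.dom = B.hom) (hcod : s ≫ C.cod = r ≫ A.hom) :
    (shriek C).map t ≫ shriekMap r s hdom hcod =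
      shriekMap (t.left ≫ r) (t.left ≫ s) (by simp [hdom]) (by simp [hcod]) := by
  apply hom_ext
  refine (congrArg (· ≫ (shriekMap r s hdom hcod).hom.left) (shriek_map_left t)).trans
    ((lift_shriekMap_left r s hdom hcod _ _ _).trans
      ((lift_congr _ ?_ ?_).trans (shriekMap_left _ _ _ _).symm))
  · exact Category.assoc _ _ _
  · exact C.compose_congr _ (Category.assoc _ _ _) rfl

theorem shriekMap_shriek_map {Z A' A : Over C.C₀} (g : Z.left ⟶ A'.left)
    (s : Z.left ⟶ C.C₁) (hdom : s ≫ C.dom = Z.hom) (hcod : s ≫ C.cod = g ≫ A'.hom) (h : A' ⟶ A) :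
    shriekMap g s hdom hcod ≫ (shriek C).map h =
      shriekMap (g ≫ h.left) s hdom (by simp [hcod]) := by
  apply hom_ext
  refine (congrArg (· ≫ ((shriek C).map h).hom.left) (shriekMap_left g s hdom hcod)).trans
    ((lift_shriek_map_left h _ _ _).trans
      ((lift_congr _ ?_ ?_).trans (shriekMap_left _ _ _ _).symm))
  · exact Category.assoc _ _ _
  · rfl

end

section Regular

variable {E : Type u} [Category.{v} E] [Regular E] {C : InternalCategory E}

theorem isPullback_shriekMap {Z A' B A : Over C.C₀} {t : Z ⟶ B} {h : A' ⟶ A}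
    {g : Z.left ⟶ A'.left} {r : B.left ⟶ A.left} {s' : Z.left ⟶ C.C₁} {s : B.left ⟶ C.C₁}
    (hdom' : s' ≫ C.dom = Z.hom) (hcod' : s' ≫ C.cod = g ≫ A'.hom)
    (hdom : s ≫ C.dom = B.hom) (hcod : s ≫ C.cod = r ≫ A.hom) (hs : t.left ≫ s = s')
    (H : IsPullback t.left g r h.left) :
    IsPullback ((shriek C).map t) (shriekMap g s' hdom' hcod') (shriekMap r s hdom hcod)
      ((shriek C).map h) := by
  subst hs
  have w : (shriek C).map t ≫ shriekMap r s hdom hcod =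
      shriekMap g _ hdom' hcod' ≫ (shriek C).map h := by
    refine (shriek_map_shriekMap t r s hdom hcod).trans
      (Eq.trans ?_ (shriekMap_shriek_map g _ hdom' hcod' h).symm)
    congr 1
    exact H.w
  have hfst {B A : Over C.C₀} (r : B.left ⟶ A.left) (s : B.left ⟶ C.C₁)
      (hdom : s ≫ C.dom = B.hom) (hcod : s ≫ C.cod = r ≫ A.hom) :
      (shriekMap r s hdom hcod).hom.left ≫ pullback.fst A.hom C.cod =
        pullback.fst B.hom C.cod ≫ r := by
    rw [shriekMap_left]
    exact pullback.lift_fst _ _ _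
  -- The underlying square, placed on the pullback square of projections from `π_! h` to `h`, has
  -- the same outer rectangle as the pullback square of projections from `π_! t` to `t` placed on
  -- the square `H`.
  refine IsPullback.of_map (carrier C) w (IsPullback.of_bot ?_ (congrArg (fun G => G.hom.left) w)
    (isPullback_shriek_map h))
  have key (u : ((shriek C).obj Z).obj.left ⟶ A'.left) (v : ((shriek C).obj B).obj.left ⟶ A.left)
      (hu : u = pullback.fst Z.hom C.cod ≫ g) (hv : v = pullback.fst B.hom C.cod ≫ r) :
      IsPullback ((shriek C).map t).hom.left u v h.left := by
    subst hu hv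
    exact (isPullback_shriek_map t).paste_vert H
  exact key _ _ (hfst _ _ _ _) (hfst _ _ _ _)

theorem extremalEpi_shriek_map {B A : Over C.C₀} (u : B ⟶ A) (hu : ExtremalEpi u.left) :
    ExtremalEpi ((shriek C).map u) :=
  (extremalEpi_iff _).2 (extremalEpi_of_isPullback (isPullback_shriek_map u).flip hu)

/-- `π_!` preserves covering squares. -/
theorem coveringSquare_shriekMap {Z A' B A : Over C.C₀} {t : Z ⟶ B} {h : A' ⟶ A}
    {g : Z.left ⟶ A'.left} {r : B.left ⟶ A.left} {s' : Z.left ⟶ C.C₁} {s : B.left ⟶ C.C₁}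
    (hdom' : s' ≫ C.dom = Z.hom) (hcod' : s' ≫ C.cod = g ≫ A'.hom)
    (hdom : s ≫ C.dom = B.hom) (hcod : s ≫ C.cod = r ≫ A.hom) (hs : t.left ≫ s = s')
    (H : CoveringSquare t.left g r h.left) :
    CoveringSquare ((shriek C).map t) (shriekMap g s' hdom' hcod') (shriekMap r s hdom hcod)
      ((shriek C).map h) := by
  subst hs
  obtain ⟨⟨P, π₁, π₂, e, hP, rfl, he₂, he⟩, hh⟩ := H
  let P' : Over C.C₀ := Over.mk (π₂ ≫ B.hom)
  let e' : Z ⟶ P' := Over.homMk e (by rw [← Over.w t, ← he₂]; simp [P'])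
  let t' : P' ⟶ B := Over.homMk π₂ rfl
  have ht : t = e' ≫ t' := by
    ext
    exact he₂.symm
  have htm : (shriek C).map t = (shriek C).map e' ≫ (shriek C).map t' := by
    rw [ht, Functor.map_comp]
  have hw : π₁ ≫ A'.hom = π₂ ≫ r ≫ A.hom := by
    rw [← Over.w h, ← Category.assoc, hP.w, Category.assoc]
  have hP' := isPullback_shriekMap (t := t') (h := h) (g := π₁) (s' := π₂ ≫ s)
    (by simp [P', hdom]) (by rw [Category.assoc, hcod, hw]) hdom hcod rfl hP.flip
  have hg := shriek_map_shriekMap e' π₁ (π₂ ≫ s) (by simp [P', hdom])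
    (by rw [Category.assoc, hcod, hw])
  refine ⟨?_, extremalEpi_shriek_map h hh⟩
  have := (QuasiPullback.of_isPullback hP'.flip).precomp (extremalEpi_shriek_map e' he)
  rw [htm]
  have key (G : (shriek C).obj Z ⟶ (shriek C).obj A')
      (hG : G = (shriek C).map e' ≫ shriekMap π₁ (π₂ ≫ s) (by simp [P', hdom])
        (by rw [Category.assoc, hcod, hw])) :
      QuasiPullback ((shriek C).map e' ≫ (shriek C).map t') G (shriekMap r s hdom hcod)
        ((shriek C).map h) := by
    subst hG
    exact this
  refine key _ (Eq.trans (shriekMap_congr _ _ rfl ?_) hg.symm)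
  rw [← he₂, Category.assoc]
  rfl

/-- The counit `(x, f) ↦ x · f` of the adjunction between `π_!` and `π^*` is a cover. -/
theorem extremalEpi_transpose_id (X : Presheaf C) :
    ExtremalEpi (transpose (Y := X) (𝟙 X.obj)) := by
  rw [extremalEpi_iff]
  have : IsSplitEpi (transpose (Y := X) (𝟙 X.obj)).hom.left :=
    ⟨⟨(shriekUnit X.obj).left, congrArg (fun u => u.left) (shriekUnit_transpose (𝟙 X.obj))⟩⟩
  infer_instance

end Regular

section Small

variable {E : Type u} [Category.{v} E] [PositiveHeyting E] {S : MorphismProperty E}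
  {C : InternalCategory E}

theorem pointwiseSmall_shriekMap (hS : IsClassOfSmallMaps S) (hC : S C.cod) {B A : Over C.C₀}
    (r : B.left ⟶ A.left) (s : B.left ⟶ C.C₁) (hdom : s ≫ C.dom = B.hom)
    (hcod : s ≫ C.cod = r ≫ A.hom) (hr : S r) :
    pointwiseSmall C S (shriekMap r s hdom hcod) := by
  rw [pointwiseSmall_iff, shriekMap_left]
  -- The map factors through `B ×_A π_! A`, which maps to `π_! A` by a pullback of `r`. The first
  -- factor `l` is small because composing it with the projection to `B` gives a pullback of `cod`.
  let m : pullback B.hom C.cod ⟶ pullback A.hom C.cod :=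
    pullback.lift (pullback.fst B.hom C.cod ≫ r)
      (C.compose (pullback.fst B.hom C.cod ≫ s) (pullback.snd B.hom C.cod)
        (by simp [hdom, pullback.condition])) (by simp [hcod])
  let l : pullback B.hom C.cod ⟶ pullback r (pullback.fst A.hom C.cod) :=
    pullback.lift (pullback.fst B.hom C.cod) m (by simp [m])
  have hl : l ≫ pullback.snd r (pullback.fst A.hom C.cod) = m := pullback.lift_snd _ _ _
  change S m
  rw [← hl]
  refine hS.comp_small (hS.of_comp l (pullback.fst _ _) ?_)
    (hS.pullback_stable (IsPullback.of_hasPullback _ _) hr)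
  have hl' : l ≫ pullback.fst r (pullback.fst A.hom C.cod) = pullback.fst B.hom C.cod :=
    pullback.lift_fst _ _ _
  rw [hl']
  exact hS.pullback_stable (IsPullback.of_hasPullback _ _).flip hC

end Small

end Presheaf

/-! ### Locally small maps, collection and representability -/

namespace Presheaf

variable {E : Type u} [Category.{v} E] [PositiveHeyting E] {S : MorphismProperty E}
  {C : InternalCategory E}

/-- A pointwise small map `F : Y ⟶ X` is pulled back along the counit `π_! π^* X ⟶ X`. An element
`y` of the pullback `P` lies over some `(x, f)`, and the family of these pairs is the datum of a
map `(r, s)_! : π_! π^* P ⟶ π_! π^* X`, which is the composite of the counit of `P` and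
`P ⟶ π_! π^* X`. -/
theorem locallySmall_of_pointwiseSmall (hS : IsClassOfSmallMaps S) (hC : S C.cod)
    {X Y : Presheaf C} (F : Y ⟶ X) (hF : pointwiseSmall C S F) : locallySmall C S F := by
  let p : piShriek X.obj ⟶ X := transpose (Y := X) (𝟙 X.obj)
  let P := pullback p F
  let G : P ⟶ piShriek X.obj := pullback.fst p F
  obtain ⟨G', hG'⟩ : ∃ G' : P.obj.left ⟶ pullback X.obj.hom C.cod, G' = G.hom.left := ⟨_, rfl⟩
  have hw : G' ≫ pullback.snd X.obj.hom C.cod ≫ C.dom = P.obj.hom := by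
    rw [hG']
    exact Over.w G.hom
  have hG : S G' := by
    rw [hG']
    exact hS.pullback_stable ((IsPullback.of_hasPullback p F).map (carrier C)).flip hF
  have hdom : (G' ≫ pullback.snd X.obj.hom C.cod) ≫ C.dom = P.obj.hom := by simpa using hw
  have hcod : (G' ≫ pullback.snd X.obj.hom C.cod) ≫ C.cod =
      (G' ≫ pullback.fst X.obj.hom C.cod) ≫ X.obj.hom := by simp [pullback.condition]
  have hrs : shriekMap (B := P.obj) (A := X.obj) (G' ≫ pullback.fst _ _) (G' ≫ pullback.snd _ _)
      hdom hcod = transpose (Y := P) (𝟙 P.obj) ≫ G := by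
    apply shriek_hom_ext
    have h₁ : shriekUnit P.obj ≫ (transpose (Y := P) (𝟙 P.obj)).hom ≫ G.hom = G.hom := by
      rw [← Category.assoc, shriekUnit_transpose, Category.id_comp]
    refine (shriekUnit_transpose (Y := piShriek X.obj) _).trans (Eq.trans ?_ h₁.symm)
    ext
    refine Eq.trans ?_ hG'
    exact (eq_lift G').symm
  refine ⟨P.obj, X.obj, _, _, hdom, hcod, hS.comp_small hG
    (hS.pullback_stable (IsPullback.of_hasPullback _ _).flip hC),
    transpose (Y := P) (𝟙 P.obj) ≫ pullback.snd p F, p, ?_, extremalEpi_transpose_id X⟩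
  rw [hrs]
  exact (QuasiPullback.of_isPullback (IsPullback.of_hasPullback p F)).precomp
    (extremalEpi_transpose_id P)

theorem pointwiseSmall_of_locallySmall (hS : IsClassOfSmallMaps S) (hC : S C.cod)
    {X Y : Presheaf C} (F : Y ⟶ X) (hF : locallySmall C S F) : pointwiseSmall C S F := by
  obtain ⟨B, A, r, s, hdom, hcod, hr, t, p, ⟨P, π₁, π₂, e, hP, he₁, rfl, he⟩, hp⟩ := hF
  have h := pointwiseSmall_shriekMap hS hC r s hdom hcod hr
  refine hS.descent (hP.map (carrier C)).flip ((extremalEpi_iff p).1 hp)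
    (hS.quotients ((extremalEpi_iff e).1 he) ?_)
  rw [← he₁] at h
  exact h

/-- Collection for presheaves follows from collection in `E`, applied to a cover of `B` consisting
of the elements of `Y` over the generators `(b, id)` of `π_! B`. -/
theorem collection_pointwiseSmall (hS : IsClassOfSmallMaps S) (hC : S C.cod) :
    Collection (pointwiseSmall C S) := by
  intro Y X A p F hp hF
  obtain ⟨B, A₀, r, s, hdom, hcod, hr, t, q, hq⟩ := locallySmall_of_pointwiseSmall hS hC F hF
  obtain ⟨b, hb⟩ : ∃ b : B ⟶ X.obj, b = shriekUnit B ≫ t.hom := ⟨_, rfl⟩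
  obtain ⟨Z, A', k, y, g, h, hky, hg, hsq⟩ : ∃ (Z A' : E) (k : Z ⟶ B.left) (y : Z ⟶ Y.obj.left)
      (g : Z ⟶ A') (h : A' ⟶ A₀.left), k ≫ b.left = y ≫ p.hom.left ∧ S g ∧
        CoveringSquare k g r h := by
    obtain ⟨Z, A', q', g, h, hg, hsq⟩ := hS.collection (pullback.fst b.left p.hom.left) r
      (extremalEpi_of_isPullback (IsPullback.of_hasPullback _ _).flip ((extremalEpi_iff p).1 hp)) hr
    exact ⟨Z, A', q' ≫ pullback.fst _ _, q' ≫ pullback.snd _ _, g, h,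
      by simp [pullback.condition], hg, hsq⟩
  let Z' : Over C.C₀ := Over.mk (k ≫ B.hom)
  let A'' : Over C.C₀ := Over.mk (h ≫ A₀.hom)
  let tZ : Z' ⟶ B := Over.homMk k rfl
  let hA : A'' ⟶ A₀ := Over.homMk h rfl
  let u : Z' ⟶ Y.obj := Over.homMk y (by
    rw [← Over.w p.hom, ← Category.assoc, ← hky, Category.assoc, Over.w]
    rfl)
  have hdom' : (k ≫ s) ≫ C.dom = k ≫ B.hom := by rw [Category.assoc, hdom]
  have hcod' : (k ≫ s) ≫ C.cod = g ≫ h ≫ A₀.hom := by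
    rw [Category.assoc, hcod, ← Category.assoc, ← Category.assoc, hsq.1.w]
  have hsq' := coveringSquare_shriekMap (Z := Z') (A' := A'') (t := tZ) (h := hA) (g := g)
    hdom' hcod' hdom hcod rfl hsq
  -- The generators `(b, id)` with `b` in the image of `Z` are sent to elements of `X` which lift
  -- to `Y`.
  have htop : (shriek C).map tZ ≫ t = transpose (Y := Y) u ≫ p := by
    apply shriek_hom_ext
    have h₁ : shriekUnit Z' ≫ ((shriek C).map tZ).hom ≫ t.hom = tZ ≫ b := by
      rw [hb]
      exact (Category.assoc _ _ _).symm.trans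
        ((congrArg (· ≫ t.hom) (shriekUnit_shriek_map tZ)).trans (Category.assoc _ _ _))
    have h₂ : shriekUnit Z' ≫ (transpose (Y := Y) u).hom ≫ p.hom = u ≫ p.hom := by
      rw [← Category.assoc, shriekUnit_transpose]
    have h₃ : tZ ≫ b = u ≫ p.hom := by
      ext
      exact hky
    exact h₁.trans (h₃.trans h₂.symm)
  have hsmall := pointwiseSmall_shriekMap (B := Z') (A := A'') hS hC g (k ≫ s) hdom' hcod' hg
  refine ⟨piShriek Z', piShriek A'', transpose (Y := Y) u,
    shriekMap (B := Z') (A := A'') g (k ≫ s) hdom' hcod', (shriek C).map hA ≫ q,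
    hsmall, ?_⟩
  have hsq'' := hsq'.paste hq
  rw [htop] at hsq''
  exact hsq''

end Presheaf

/-! ### Representability -/

/-- The object of pairs `(i, x)` of an element `i : U ⨯ C₀` and a family `x` of elements of the
fibre of `q : K ⟶ C₀` indexed by the fibre of `π` over `i` carries the universal family of elements
of fibres of `q` whose index object is a pullback of `π`. -/
theorem exists_universal_family {E : Type u} [Category.{v} E] [PositiveHeyting E]
    {S : MorphismProperty E} (hS : IsPredicative S) {V U K C₀ : E} (π : V ⟶ U) (hπ : S π)
    (q : K ⟶ C₀) :
    ∃ (Z W : E) (r : Z ⟶ W) (s : Z ⟶ K) (c : W ⟶ C₀), S r ∧ s ≫ q = r ≫ c ∧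
      ∀ ⦃B A : E⦄ (m : B ⟶ V) (g : B ⟶ A) (n : A ⟶ U) (s' : B ⟶ K) (c' : A ⟶ C₀),
        IsPullback m g π n → s' ≫ q = g ≫ c' →
          ∃ (b : B ⟶ Z) (a : A ⟶ W), IsPullback b g r a ∧ b ≫ s = s' ∧ a ≫ c = c' := by
  let ρ : pullback π (prod.fst : U ⨯ C₀ ⟶ U) ⟶ U ⨯ C₀ := pullback.snd π prod.fst
  have hρ : S ρ := hS.pullback_stable (IsPullback.of_hasPullback _ _) hπ
  have := hS.exponentiable ρ hρ
  let adj := Adjunction.ofIsLeftAdjoint (Over.pullback ρ)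
  let G : Over (pullback π (prod.fst : U ⨯ C₀ ⟶ U)) :=
    Over.mk (pullback.snd q (ρ ≫ prod.snd))
  let W := (Over.pullback ρ).rightAdjoint.obj G
  let ev : pullback W.hom ρ ⟶ pullback q (ρ ≫ prod.snd) := (adj.counit.app G).left
  have hev : ev ≫ pullback.snd q (ρ ≫ prod.snd) = pullback.snd W.hom ρ :=
    Over.w (adj.counit.app G)
  refine ⟨pullback W.hom ρ, W.left, pullback.fst W.hom ρ, ev ≫ pullback.fst _ _,
    W.hom ≫ prod.snd, hS.pullback_stable (IsPullback.of_hasPullback _ _).flip hρ, ?_, ?_⟩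
  · rw [Category.assoc, pullback.condition, reassoc_of% hev, pullback.condition_assoc]
  · intro B A m g n s' c' hg hs
    -- Since `B` is the pullback of `ρ` along `i = (n, c')`, the family `s'` is a map from the
    -- pullback of `i` to `G`, and its transpose `a` classifies the family.
    let i : A ⟶ U ⨯ C₀ := prod.lift n c'
    let m' : B ⟶ pullback π (prod.fst : U ⨯ C₀ ⟶ U) :=
      pullback.lift m (g ≫ i) (by simp [i, hg.w])
    have hm' : IsPullback m' g ρ i := by
      refine IsPullback.of_right ?_ (pullback.lift_snd _ _ _) (IsPullback.of_hasPullback _ _)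
      simpa [m', i] using hg
    let I : Over (U ⨯ C₀) := Over.mk i
    let φ : pullback i ρ ≅ B := (IsPullback.of_hasPullback i ρ).isoIsPullback _ _ hm'.flip
    have hφ₁ : φ.hom ≫ g = pullback.fst i ρ := IsPullback.isoIsPullback_hom_fst _ _ _ _
    have hφ₂ : φ.hom ≫ m' = pullback.snd i ρ := IsPullback.isoIsPullback_hom_snd _ _ _ _
    let x : (Over.pullback ρ).obj I ⟶ G := Over.homMk
      (pullback.lift (φ.hom ≫ s') (pullback.snd i ρ) (by
        rw [Category.assoc, hs, reassoc_of% hφ₁, ← pullback.condition_assoc]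
        simp [i])) (pullback.lift_snd _ _ _)
    let a : I ⟶ W := adj.homEquiv I G x
    have hx : (Over.pullback ρ).map a ≫ adj.counit.app G = x := by
      exact (adj.homEquiv_counit _ _ _).symm.trans ((adj.homEquiv I G).symm_apply_apply x)
    have ha : a.left ≫ W.hom = i := Over.w a
    let b : B ⟶ pullback W.hom ρ := pullback.lift (g ≫ a.left) m' (by
      rw [Category.assoc, ha, hm'.w])
    have hb : IsPullback b g (pullback.fst W.hom ρ) a.left := by
      refine IsPullback.of_right (h₁₂ := pullback.snd W.hom ρ) ?_ (pullback.lift_fst _ _ _)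
        (IsPullback.of_hasPullback W.hom ρ).flip
      rw [ha, pullback.lift_snd]
      exact hm'
    refine ⟨b, a.left, hb, ?_, by rw [reassoc_of% ha]; simp [i]⟩
    have hφb : φ.hom ≫ b = ((Over.pullback ρ).map a).left := by
      apply pullback.hom_ext
      · simp [b, reassoc_of% hφ₁]
        rfl
      · simp [b, hφ₂, I]
    rw [← cancel_epi φ.hom, reassoc_of% hφb]
    have := congrArg (fun k => k.left ≫ pullback.fst q (ρ ≫ prod.snd)) hx
    refine Eq.trans ((Category.assoc _ _ _).symm.trans this) ?_
    exact pullback.lift_fst _ _ _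

namespace Presheaf

variable {E : Type u} [Category.{v} E] [PositiveHeyting E] {S : MorphismProperty E}
  {C : InternalCategory E}

/-- The map `(r, s)_!` of the universal family `s` of arrows of `C` with a common codomain and
indexed by a fibre of the universal small map is a universal pointwise small map. -/
theorem representability_pointwiseSmall (hS : IsPredicative S) (hC : S C.cod) :
    Representability (pointwiseSmall C S) := by
  obtain ⟨V, U, π, hπ, hcover⟩ := hS.representability
  obtain ⟨Z, W, r₀, s₀, c₀, hr₀, hs₀, huniv⟩ := exists_universal_family hS π hπ C.cod
  let Z₀ : Over C.C₀ := Over.mk (s₀ ≫ C.dom)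
  let W₀ : Over C.C₀ := Over.mk c₀
  refine ⟨piShriek Z₀, piShriek W₀, shriekMap (B := Z₀) (A := W₀) r₀ s₀ rfl hs₀,
    pointwiseSmall_shriekMap hS.toIsClassOfSmallMaps hC _ _ _ _ hr₀, fun Y X F hF => ?_⟩
  obtain ⟨B, A, r, s, hdom, hcod, hr, t, p, hF'⟩ :=
    locallySmall_of_pointwiseSmall hS.toIsClassOfSmallMaps hC F hF
  obtain ⟨B', A', g, t', p', m, n, hsq, hg⟩ := hcover r hr
  have hcod' : (t' ≫ s) ≫ C.cod = g ≫ p' ≫ A.hom := by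
    rw [Category.assoc, hcod, ← Category.assoc, ← Category.assoc, hsq.1.w]
  have hdom' : (t' ≫ s) ≫ C.dom = t' ≫ B.hom := by rw [Category.assoc, hdom]
  obtain ⟨b, a, hab, hb, ha⟩ := huniv m g n (t' ≫ s) (p' ≫ A.hom) hg hcod'
  let B'' : Over C.C₀ := Over.mk (t' ≫ B.hom)
  let A'' : Over C.C₀ := Over.mk (p' ≫ A.hom)
  let bB : B'' ⟶ Z₀ := Over.homMk b (by
    change b ≫ s₀ ≫ C.dom = t' ≫ B.hom
    rw [← Category.assoc, hb, hdom'])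
  let aA : A'' ⟶ W₀ := Over.homMk a ha
  have h₁ := coveringSquare_shriekMap (Z := B'') (A' := A'') (t := Over.homMk t' rfl)
    (h := Over.homMk p' rfl) (g := g) hdom' hcod' hdom hcod rfl hsq
  have h₂ := isPullback_shriekMap (Z := B'') (A' := A'') (B := Z₀) (A := W₀) (t := bB) (h := aA)
    (g := g) hdom' hcod' rfl hs₀ hb hab
  exact ⟨_, _, _, _, _, _, _, h₁.paste hF', h₂⟩

end Presheaf

end SmallMaps

theorem mainTheorem12 {E : Type u} [Category.{v} E] [SmallMaps.PositiveHeyting E]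
    (S : MorphismProperty E) (hS : SmallMaps.IsPredicative S)
    (C : SmallMaps.InternalCategory E) (hcod : S C.cod) :
    (∃ _ : SmallMaps.PositiveHeyting (SmallMaps.Presheaf C),
      SmallMaps.IsClassOfSmallMaps (SmallMaps.pointwiseSmall C S)) ∧
    (∀ {Y X : SmallMaps.Presheaf C} (F : Y ⟶ X),
      SmallMaps.pointwiseSmall C S F ↔ SmallMaps.locallySmall C S F) ∧
    SmallMaps.Collection (SmallMaps.pointwiseSmall C S) ∧
    SmallMaps.Representability (SmallMaps.pointwiseSmall C S) := by
  have hS' := hS.toIsClassOfSmallMaps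
  have hcoll := SmallMaps.Presheaf.collection_pointwiseSmall hS' hcod
  exact ⟨⟨inferInstance, SmallMaps.Presheaf.isClassOfSmallMaps_pointwiseSmall hS' hcod hcoll⟩,
    fun F => ⟨SmallMaps.Presheaf.locallySmall_of_pointwiseSmall hS' hcod F,
      SmallMaps.Presheaf.pointwiseSmall_of_locallySmall hS' hcod F⟩,
    hcoll, SmallMaps.Presheaf.representability_pointwiseSmall hS hcod⟩
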